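/- **Theorem (Noncommutative Lévy inequality).** Let $\mathfrak M$ be a von Neumann algebra on a complex Hilbert space, with a normal faithful tracial state $\tau$. For a self-adjoint $x\in\mathfrak M$ and a Borel set $B\subseteq\mathbb R$, let $e_B(x)\in\mathfrak M$ be the spectral projection of $x$ corresponding to $B$. Let $x_1,\dots,x_n\in\mathfrak M$ be self-adjoint elements, with partial sums $s_k=x_1+\cdots+x_k$, such that * (weakly full independence) for every $1<j\le n$, $\tau(ab)=\tau(a)\tau(b)$ for all $a\in W^*(x_1,\dots,x_{j-1})$ and $b\in W^*(x_j,\dots,x_n)$, where $W^*(S)$ is the von Neumann algebra generated by $S$; * (symmetry) for every $i$, $\tau(e_B(x_i))=\tau(e_B(-x_i))$ for every Borel set $B\subseteq\mathbb R$; * $s_ks_n=s_ns_k$ for all $1\le k\le n$. Then for each $\lambda>0$ there exist projections $p,q\in\mathfrak M$ such that $$\max_{1\le k\le n}\frac1{2^{k-1}}\,\tau\big(e_{(\lambda,\infty)}(s_k)\big)\;\le\;\tau(p)\;\le\;2\,\tau\big(e_{(\lambda,\infty)}(s_n)\big)$$ and $$\max_{1\le k\le n}\frac1{2^{k-1}}\,\tau\big(e_{(\lambda,\infty)}(|s_k|)\big)\;\le\;\tau(p+q)\;\le\;2\,\tau\big(e_{(\lambda,\infty)}(|s_n|)\big);$$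 moreover, if $e_{(\lambda,\infty)}(s_k)\ne0$ for some $1\le k\le n$, then $p\ne0$, and if $e_{(\lambda,\infty)}(-s_k)\ne0$ for some $1\le k\le n$, then $q\ne0$. -/

import Mathlib

namespace NCLevy

noncomputable section

variable {H : Type*} [NormedAddCommGroup H] [InnerProductSpace ℂ H] [CompleteSpace H]

/-- For a bounded self-adjoint operator `x` with spectral measure `E` and an open `U ⊆ ℝ`, the range
of `E(U)`: the closed linear span of the ranges of the operators `f(x)` (continuous functional
calculus), where `f` runs over the continuous functions `ℝ → ℝ` that vanish outside `U`. -/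
def openSpectralSubspace (x : H →L[ℂ] H) (U : Set ℝ) : Submodule ℂ H :=
  (⨆ f ∈ {f : C(ℝ, ℝ) | ∀ t, t ∉ U → f t = 0},
    LinearMap.range (cfc (fun t => f t) x : H →L[ℂ] H).toLinearMap).topologicalClosure

/-- For a bounded self-adjoint operator `x` with spectral measure `E` and a Borel set `B ⊆ ℝ`, the
range of `E(B)`. The finite Borel measures `B ↦ ⟪ξ, E(B) ξ⟫` are outer regular, so
`E(B)` is the infimum of the projections `E(U)` over the open sets `U ⊇ B`. -/
def spectralSubspace (x : H →L[ℂ] H) (B : Set ℝ) : Submodule ℂ H :=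
  ⨅ U ∈ {U : Set ℝ | IsOpen U ∧ B ⊆ U}, openSpectralSubspace x U

theorem isClosed_spectralSubspace (x : H →L[ℂ] H) (B : Set ℝ) :
    IsClosed (spectralSubspace x B : Set H) := by
  simp only [spectralSubspace, Submodule.coe_iInf]
  exact isClosed_biInter fun U _ => Submodule.isClosed_topologicalClosure _

instance instCompleteSpaceSpectralSubspace (x : H →L[ℂ] H) (B : Set ℝ) :
    CompleteSpace (spectralSubspace x B) :=
  (isClosed_spectralSubspace x B).completeSpace_coe

/-- The spectral projection `e_B(x) = E(B)` of a bounded self-adjoint operator `x`, where `E` is the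
spectral measure of `x` and `B ⊆ ℝ` is Borel: the orthogonal projection onto `E(B)H`. -/
def spectralProj (x : H →L[ℂ] H) (B : Set ℝ) : H →L[ℂ] H :=
  (spectralSubspace x B).starProjection

theorem isStarProjection_spectralProj (x : H →L[ℂ] H) (B : Set ℝ) :
    IsStarProjection (spectralProj x B) :=
  isStarProjection_starProjection

/-- Spectral subspaces of `x` are invariant under every operator that commutes with `x`. -/
theorem mapsTo_spectralSubspace {x y : H →L[ℂ] H} (h : Commute x y) (B : Set ℝ) {v : H}
    (hv : v ∈ spectralSubspace x B) : y v ∈ spectralSubspace x B := by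
  simp only [spectralSubspace, Submodule.mem_iInf] at hv ⊢
  intro U hU
  have hvU := hv U hU
  unfold openSpectralSubspace at hvU ⊢
  set K : Submodule ℂ H := ⨆ f ∈ {f : C(ℝ, ℝ) | ∀ t, t ∉ U → f t = 0},
    LinearMap.range (cfc (fun t => f t) x : H →L[ℂ] H).toLinearMap with hK
  have hKy : K ≤ K.comap y.toLinearMap := by
    rw [hK]
    refine iSup₂_le fun f hf => ?_
    rintro _ ⟨w, rfl⟩
    refine Submodule.mem_comap.2 (Submodule.mem_iSup_of_mem f (Submodule.mem_iSup_of_mem hf ?_))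
    have hc : Commute (cfc (fun t => f t) x : H →L[ℂ] H) y := by
      by_cases hx : IsSelfAdjoint x
      · exact hx.commute_cfc h _
      · rw [cfc_apply_of_not_predicate x hx]
        exact Commute.zero_left y
    exact ⟨y w, congrArg (fun T : H →L[ℂ] H => T w) hc.eq⟩
  have hmt : Set.MapsTo y (K : Set H) (K : Set H) := fun w hw => hKy hw
  exact hmt.closure y.continuous hvU

theorem spectralProj_mem (M : VonNeumannAlgebra H) {x : H →L[ℂ] H} (hx : x ∈ M) (B : Set ℝ) :
    spectralProj x B ∈ M := by
  rw [VonNeumannAlgebra.IsStarProjection.mem_iff (isStarProjection_spectralProj x B) M]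
  intro y hy
  have hrange : (spectralProj x B).range = spectralSubspace x B :=
    Submodule.range_starProjection _
  rw [hrange]
  intro v hv
  exact mapsTo_spectralSubspace (VonNeumannAlgebra.mem_commutant_iff.1 hy x hx) B hv

theorem abs_mem (M : VonNeumannAlgebra H) {x : H →L[ℂ] H} (hx : x ∈ M) : CFC.abs x ∈ M := by
  rw [← VonNeumannAlgebra.commutant_commutant M, VonNeumannAlgebra.mem_commutant_iff]
  intro y hy
  rw [VonNeumannAlgebra.mem_commutant_iff] at hy
  have h1 : Commute x y := hy x hx
  have h2 : Commute (star x) y := hy (star x) (star_mem hx)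
  exact ((h2.mul_left h1).cfcₙ_nnreal NNReal.sqrt).symm.eq

/-- The spectral projection `e_B(x)`, as an element of the von Neumann algebra `M ∋ x`. -/
def eProj {M : VonNeumannAlgebra H} (B : Set ℝ) (x : M.toStarSubalgebra) : M.toStarSubalgebra :=
  ⟨spectralProj (x : H →L[ℂ] H) B, spectralProj_mem M x.2 B⟩

/-- The absolute value `|x| = (x* x)^{1/2}`, as an element of the von Neumann algebra `M ∋ x`. -/
def absM {M : VonNeumannAlgebra H} (x : M.toStarSubalgebra) : M.toStarSubalgebra :=
  ⟨CFC.abs (x : H →L[ℂ] H), abs_mem M x.2⟩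

open scoped ComplexOrder in
/-- `τ` is a normal faithful tracial state on `M`. Normality: `τ` preserves suprema of (bounded)
upward directed sets of self-adjoint elements. -/
structure IsNormalFaithfulTracialState {M : VonNeumannAlgebra H}
    (τ : M.toStarSubalgebra →ₗ[ℂ] ℂ) : Prop where
  map_one : τ 1 = 1
  nonneg : ∀ a, 0 ≤ τ (star a * a)
  faithful : ∀ a, τ (star a * a) = 0 → a = 0
  tracial : ∀ a b, τ (a * b) = τ (b * a)
  normal : ∀ (D : Set M.toStarSubalgebra) (a : M.toStarSubalgebra),
    D.Nonempty → (∀ d ∈ D, IsSelfAdjoint d) → DirectedOn (· ≤ ·) D → IsLUB D a →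
      IsLUB ((fun d => (τ d).re) '' D) (τ a).re

/-- `W*(S)`, the von Neumann algebra generated by `S`: the double commutant of `S ∪ S*`. -/
def wStar (S : Set (H →L[ℂ] H)) : VonNeumannAlgebra H where
  toStarSubalgebra := StarSubalgebra.centralizer ℂ
    (StarSubalgebra.centralizer ℂ S : Set (H →L[ℂ] H))
  centralizer_centralizer' := by
    simp

/-- `W*(S)` is the smallest von Neumann algebra that contains `S`. -/
theorem wStar_le_iff (S : Set (H →L[ℂ] H)) (N : VonNeumannAlgebra H) :
    wStar S ≤ N ↔ S ⊆ (N : Set (H →L[ℂ] H)) := by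
  have hmem : ∀ a, a ∈ wStar S ↔ a ∈ StarSubalgebra.centralizer ℂ
      (StarSubalgebra.centralizer ℂ S : Set (H →L[ℂ] H)) := fun a => Iff.rfl
  constructor
  · intro h a ha
    refine h ((hmem a).2 (StarSubalgebra.mem_centralizer_iff ℂ |>.2 fun g hg => ?_))
    have hg1 := StarSubalgebra.mem_centralizer_iff ℂ |>.1 hg a ha
    have hg2 := StarSubalgebra.mem_centralizer_iff ℂ |>.1 (star_mem hg) a ha
    exact ⟨hg1.1.symm, hg2.1.symm⟩
  · intro h a ha
    rw [← VonNeumannAlgebra.commutant_commutant N, VonNeumannAlgebra.mem_commutant_iff]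
    intro y hy
    rw [VonNeumannAlgebra.mem_commutant_iff] at hy
    refine (StarSubalgebra.mem_centralizer_iff ℂ |>.1 ((hmem a).1 ha) y ?_).1
    exact StarSubalgebra.mem_centralizer_iff ℂ |>.2 fun g hg =>
      ⟨hy g (h hg), hy (star g) (star_mem (h hg))⟩

/-- Weakly full independence of `x₁, …, xₙ` (where `xᵢ` is `x ⟨i - 1, _⟩`): for `1 < j ≤ n`,
`τ(ab) = τ(a)τ(b)` for all `a ∈ W*(x₁, …, x_{j-1})` and `b ∈ W*(x_j, …, xₙ)`. -/
def WeaklyFullyIndependent {M : VonNeumannAlgebra H} (τ : M.toStarSubalgebra →ₗ[ℂ] ℂ)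
    {n : ℕ} (x : Fin n → M.toStarSubalgebra) : Prop :=
  ∀ j : ℕ, 1 < j → j ≤ n → ∀ a b : M.toStarSubalgebra,
    (a : H →L[ℂ] H) ∈ wStar {y | ∃ i : Fin n, (i : ℕ) + 1 < j ∧ (x i : H →L[ℂ] H) = y} →
    (b : H →L[ℂ] H) ∈ wStar {y | ∃ i : Fin n, j ≤ (i : ℕ) + 1 ∧ (x i : H →L[ℂ] H) = y} →
    τ (a * b) = τ a * τ b

/-- Self-adjoint `x`, `y` are identically distributed. -/
def IdenticallyDistributed {M : VonNeumannAlgebra H} (τ : M.toStarSubalgebra →ₗ[ℂ] ℂ)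
    (x y : M.toStarSubalgebra) : Prop :=
  ∀ B : Set ℝ, MeasurableSet B → τ (eProj B x) = τ (eProj B y)

/-- A self-adjoint `x` is symmetric if `x` and `-x` are identically distributed. -/
def IsSymmetric {M : VonNeumannAlgebra H} (τ : M.toStarSubalgebra →ₗ[ℂ] ℂ)
    (x : M.toStarSubalgebra) : Prop :=
  IdenticallyDistributed τ x (-x)

/-- The partial sum `s_k = x₁ + ⋯ + x_k` (where `xᵢ` is `x ⟨i - 1, _⟩`). -/
def partialSum {M : VonNeumannAlgebra H} {n : ℕ} (x : Fin n → M.toStarSubalgebra) (k : ℕ) :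
    M.toStarSubalgebra :=
  ∑ i ∈ (Finset.univ : Finset (Fin n)).filter (fun i : Fin n => (i : ℕ) + 1 ≤ k), x i

end

end NCLevy

namespace NCLevy

/-! ### Spectral projections of half-lines through the continuous functional calculus. -/

section Spectral

variable {H : Type*} [NormedAddCommGroup H] [InnerProductSpace ℂ H] [CompleteSpace H]

/-! The hypotheses force the `x i` to commute, after which the classical first-passage argument
applies. As `s_n` commutes with every `s_k`, it commutes with every `x_i`. Hence for `i ≤ k` the
commutator `d = [s_k, x_i]` equals `[x_i, s_n - s_k]`. Independence and traciality then give `τ(d*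
d) = 0`, and `d = 0` by faithfulness (`commute_partialSum_of_lt`,
`commute_of_weaklyFullyIndependent`).

Symmetry enters through odd moments. They vanish for each `x_i` (`IsSymmetric.tr_odd_pow`), hence
for `s_n - s_k` by the binomial formula and independence (`tr_odd_pow_sub_partialSum`). By
Weierstrass approximation and normality, such an element is strictly negative with trace at most
`1/2` (`tr_eProj_neg_le_half`).

The projection `p` is the supremum of the `e(s_k)`, split according to the first `k` with `s_k > λ`.
On each piece the independent increment `s_n - s_k` is nonnegative with trace at least `1/2`, and
there `s_n > λ`; so `τ(p) ≤ 2 τ(e(s_n))` (`exists_projection_levy`). The same for `-s_k` gives `q`,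
and `e(|s|) = e(s) + e(-s)` yields the two-sided bounds. Since `p` dominates each `e(s_k)`, the
lower bounds hold even without the weights. -/

theorem range_cfc_le_openSpectralSubspace (x : H →L[ℂ] H) {U : Set ℝ} {f : ℝ → ℝ}
    (hf : Continuous f) (h0 : ∀ t, t ∉ U → f t = 0) (v : H) :
    cfc f x v ∈ openSpectralSubspace x U := by
  refine Submodule.le_topologicalClosure _ ?_
  exact Submodule.mem_iSup_of_mem (⟨f, hf⟩ : C(ℝ, ℝ))
    (Submodule.mem_iSup_of_mem (show _ ∈ _ from h0) ⟨v, rfl⟩)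

theorem openSpectralSubspace_mono (x : H →L[ℂ] H) {U V : Set ℝ} (h : U ⊆ V) :
    openSpectralSubspace x U ≤ openSpectralSubspace x V := by
  refine Submodule.topologicalClosure_mono (iSup₂_le fun f hf => ?_)
  exact le_iSup₂_of_le f (fun t ht => hf t fun htU => ht (h htU)) le_rfl

theorem spectralSubspace_of_isOpen (x : H →L[ℂ] H) {U : Set ℝ} (hU : IsOpen U) :
    spectralSubspace x U = openSpectralSubspace x U := by
  refine le_antisymm (iInf₂_le U ⟨hU, subset_rfl⟩) (le_iInf₂ fun V hV => ?_)
  exact openSpectralSubspace_mono x hV.2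

theorem spectralProj_mul_cfc (x : H →L[ℂ] H) {U : Set ℝ} (hU : IsOpen U) {f : ℝ → ℝ}
    (hf : Continuous f) (h0 : ∀ t, t ∉ U → f t = 0) :
    spectralProj x U * cfc f x = cfc f x := by
  ext v
  refine Submodule.starProjection_eq_self_iff.2 ?_
  rw [spectralSubspace_of_isOpen x hU]
  exact range_cfc_le_openSpectralSubspace x hf h0 v

theorem cfc_mul_spectralProj (x : H →L[ℂ] H) {U : Set ℝ} (hU : IsOpen U) {f : ℝ → ℝ}
    (hf : Continuous f) (h0 : ∀ t, t ∉ U → f t = 0) :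
    cfc f x * spectralProj x U = cfc f x := by
  have h := congrArg star (spectralProj_mul_cfc x hU hf h0)
  rwa [star_mul, (isStarProjection_spectralProj x U).isSelfAdjoint.star_eq,
    (cfc_predicate f x : IsSelfAdjoint (cfc f x)).star_eq] at h

/-- For `g` supported in `U` one has `f g = 0`, so the closed kernel of `f(x)` contains the ranges
that span `E(U)H`. -/
theorem cfc_mul_spectralProj_eq_zero (x : H →L[ℂ] H) {U : Set ℝ} (hU : IsOpen U)
    {f : ℝ → ℝ} (hf : Continuous f) (h0 : ∀ t ∈ U, f t = 0) :
    cfc f x * spectralProj x U = 0 := by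
  ext v
  have hv : spectralProj x U v ∈ openSpectralSubspace x U := by
    rw [← spectralSubspace_of_isOpen x hU]
    exact Submodule.starProjection_apply_mem _ v
  have hle : openSpectralSubspace x U ≤ (cfc f x : H →L[ℂ] H).ker := by
    refine Submodule.topologicalClosure_minimal _ (iSup₂_le fun g hg => ?_)
      (cfc f x : H →L[ℂ] H).isClosed_ker
    rintro _ ⟨w, rfl⟩
    have h1 : cfc f x * cfc (fun t => g t) x = 0 := by
      rw [← cfc_mul f (fun t => g t) x hf.continuousOn g.continuous.continuousOn]
      rw [← cfc_const_zero ℝ x]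
      congr 1
      funext t
      by_cases ht : t ∈ U
      · simp [h0 t ht]
      · simp [hg t ht]
    exact congrArg (fun T : H →L[ℂ] H => T w) h1
  exact hle hv

/-- A continuous `f` vanishing off `{g > 0}` is a uniform limit on compact sets of multiples
of `g`. -/
theorem exists_norm_mul_sub_lt {K : Set ℝ} (hK : IsCompact K) {f g : ℝ → ℝ} (hf : Continuous f)
    (hg : Continuous g) (hg0 : ∀ t, 0 ≤ g t) (hfg : ∀ t, g t = 0 → f t = 0) {ε : ℝ} (hε : 0 < ε) :
    ∃ k : ℝ → ℝ, Continuous k ∧ ∀ t ∈ K, ‖f t - k t * g t‖ ≤ ε := by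
  obtain ⟨C, hC⟩ := hK.exists_bound_of_continuousOn hf.continuousOn
  have hL : IsCompact (K ∩ {t | ε ≤ ‖f t‖}) :=
    hK.inter_right (isClosed_le continuous_const hf.norm)
  obtain ⟨m, hm, hmg⟩ : ∃ m, 0 < m ∧ ∀ t ∈ K ∩ {t | ε ≤ ‖f t‖}, m ≤ g t := by
    rcases (K ∩ {t | ε ≤ ‖f t‖}).eq_empty_or_nonempty with he | hne
    · exact ⟨1, one_pos, fun t ht => absurd (he ▸ ht) (Set.notMem_empty t)⟩
    · obtain ⟨t0, ht0, hmin⟩ := hL.exists_isMinOn hne hg.continuousOn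
      refine ⟨g t0, lt_of_le_of_ne (hg0 t0) fun h => ?_, fun t ht => hmin ht⟩
      have h2 : ε ≤ ‖f t0‖ := ht0.2
      rw [hfg t0 h.symm, norm_zero] at h2
      linarith
  -- With `k = f / (g + δ)` the error is `|f| δ / (g + δ)`. Where `|f| ≥ ε` it is at most `(|C| + 1)
  -- δ / m = ε`; elsewhere it is at most `|f| < ε`.
  set δ := ε * m / (|C| + 1) with hδ
  have hδ0 : 0 < δ := by positivity
  refine ⟨fun t => f t / (g t + δ), hf.div (hg.add continuous_const)
    fun t => (by linarith [hg0 t] : 0 < g t + δ).ne', fun t ht => ?_⟩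
  have hp : 0 < g t + δ := by linarith [hg0 t]
  have heq : f t - f t / (g t + δ) * g t = f t * (δ / (g t + δ)) := by
    field_simp
    ring
  rw [heq, norm_mul, Real.norm_of_nonneg (by positivity : 0 ≤ δ / (g t + δ))]
  by_cases hc : ε ≤ ‖f t‖
  · have h1 := hmg t ⟨ht, hc⟩
    have h2 : ‖f t‖ ≤ |C| + 1 := by linarith [hC t ht, le_abs_self C]
    calc ‖f t‖ * (δ / (g t + δ)) ≤ (|C| + 1) * (δ / m) := by
          gcongr
          linarith
      _ = ε := by rw [hδ]; field_simp
  · push Not at hc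
    have h3 : δ / (g t + δ) ≤ 1 := by
      rw [div_le_one hp]
      linarith [hg0 t]
    calc ‖f t‖ * (δ / (g t + δ)) ≤ ‖f t‖ * 1 := by gcongr
      _ ≤ ε := by linarith

/-- `f(x)` is a norm limit of operators `k(x) g(x)`, all of which kill `v`. -/
theorem cfc_apply_eq_zero_of_cfc_apply_eq_zero {x : H →L[ℂ] H}
    {f g : ℝ → ℝ} (hf : Continuous f) (hg : Continuous g) (hg0 : ∀ t, 0 ≤ g t)
    (hfg : ∀ t, g t = 0 → f t = 0) {v : H} (hv : cfc g x v = 0) : cfc f x v = 0 := by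
  rw [← norm_eq_zero]
  refine le_antisymm (le_of_forall_pos_le_add fun ε hε => ?_) (norm_nonneg _)
  obtain ⟨k, hk, hb⟩ := exists_norm_mul_sub_lt
    (ContinuousFunctionalCalculus.isCompact_spectrum (R := ℝ) x) hf hg hg0 hfg
    (div_pos hε (by positivity : 0 < ‖v‖ + 1))
  have h1 : cfc (fun t => f t - k t * g t) x = cfc f x - cfc k x * cfc g x := by
    rw [cfc_sub f (fun t => k t * g t) x hf.continuousOn (hk.mul hg).continuousOn,
      cfc_mul k g x hk.continuousOn hg.continuousOn]
  have h2 : ‖cfc (fun t => f t - k t * g t) x‖ ≤ ε / (‖v‖ + 1) :=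
    norm_cfc_le (by positivity) hb
  have h3 : cfc f x v = (cfc (fun t => f t - k t * g t) x : H →L[ℂ] H) v := by
    rw [h1]
    simp [hv]
  rw [h3, zero_add]
  calc _ ≤ ε / (‖v‖ + 1) * ‖v‖ := ContinuousLinearMap.le_of_opNorm_le _ h2 v
    _ ≤ ε / (‖v‖ + 1) * (‖v‖ + 1) := by gcongr; linarith
    _ = ε := by field_simp

/-- The kernel of `E(U)` is the kernel of `g(x)`, for a continuous `g ≥ 0` with
`U = {g > 0}`. -/
theorem spectralProj_apply_eq_zero_iff {x : H →L[ℂ] H} {U : Set ℝ}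
    (hU : IsOpen U) {g : ℝ → ℝ} (hg : Continuous g) (hg0 : ∀ t, 0 ≤ g t)
    (hgU : ∀ t, g t = 0 ↔ t ∉ U) (v : H) : spectralProj x U v = 0 ↔ cfc g x v = 0 := by
  constructor
  · intro h
    rw [← cfc_mul_spectralProj x hU hg fun t ht => (hgU t).2 ht]
    simp [h]
  · intro h
    -- Each self-adjoint `f(x)` with `f` supported in `U` kills `v`, so its range is orthogonal to
    -- `v`. Then `E(U)v ⟂ v`, that is, `‖E(U)v‖² = 0`.
    have hle : openSpectralSubspace x U ≤ (ℂ ∙ v)ᗮ := by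
      refine Submodule.topologicalClosure_minimal _ (iSup₂_le fun f hf => ?_)
        (Submodule.isClosed_orthogonal _)
      rintro _ ⟨w, rfl⟩
      rw [Submodule.mem_orthogonal_singleton_iff_inner_right]
      have h1 := cfc_apply_eq_zero_of_cfc_apply_eq_zero f.continuous hg hg0
        (fun t ht => hf t ((hgU t).1 ht)) h
      have h2 : IsSelfAdjoint (cfc (fun t => f t) x : H →L[ℂ] H) := cfc_predicate _ x
      have h3 := ContinuousLinearMap.isSelfAdjoint_iff_isSymmetric.1 h2 v w
      change inner ℂ v ((cfc (fun t => f t) x : H →L[ℂ] H) w) = 0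
      refine Eq.trans (Eq.symm h3) ?_
      change inner ℂ ((cfc (fun t => f t) x : H →L[ℂ] H) v) w = 0
      rw [h1, inner_zero_left]
    have h4 : spectralProj x U v ∈ (ℂ ∙ v)ᗮ := by
      refine hle ?_
      rw [← spectralSubspace_of_isOpen x hU]
      exact Submodule.starProjection_apply_mem _ v
    rw [Submodule.mem_orthogonal_singleton_iff_inner_right] at h4
    have h5 : inner ℂ (spectralProj x U v) (spectralProj x U v) = 0 := by
      rw [← h4]
      have h6 := ContinuousLinearMap.isSelfAdjoint_iff_isSymmetric.1
        (isStarProjection_spectralProj x U).isSelfAdjoint v (spectralProj x U v)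
      change inner ℂ (spectralProj x U v) (spectralProj x U v)
        = inner ℂ v (spectralProj x U (spectralProj x U v)) at h6
      rw [h6]
      congr 1
      exact congrArg (fun T : H →L[ℂ] H => T v)
        (isStarProjection_spectralProj x U).isIdempotentElem.eq
    exact inner_self_eq_zero.1 h5

/-- Reduces identities between spectral projections to comparing kernels. Since `v - p v` lies in
`ker p ⊆ ker q`, one gets `q = q p`; symmetry and adjoints finish. -/
theorem eq_of_forall_apply_eq_zero_iff {p q : H →L[ℂ] H} (hp : IsStarProjection p)
    (hq : IsStarProjection q) (h : ∀ v, p v = 0 ↔ q v = 0) : p = q := by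
  have key : ∀ {p q : H →L[ℂ] H}, IsStarProjection p → (∀ v, p v = 0 → q v = 0) →
      q = q * p := by
    intro p q hp h
    ext v
    have h1 : p (v - p v) = 0 := by
      rw [map_sub, sub_eq_zero]
      exact congrArg (fun T : H →L[ℂ] H => T v) hp.isIdempotentElem.eq.symm
    have h2 := h _ h1
    rwa [map_sub, sub_eq_zero] at h2
  have h1 := key hp fun v => (h v).1
  have h2 := congrArg star (key hq fun v => (h v).2)
  rw [star_mul, hp.isSelfAdjoint.star_eq, hq.isSelfAdjoint.star_eq] at h2
  rw [h1]
  exact h2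

/-- Invariance of the range gives `e y e = y e`; the adjoint identity is `e y e = e y`. -/
theorem commute_spectralProj {x y : H →L[ℂ] H} (h : Commute x y) (hy : IsSelfAdjoint y)
    (B : Set ℝ) : Commute (spectralProj x B) y := by
  set e := spectralProj x B with he
  have h1 : e * y * e = y * e := by
    ext v
    refine Submodule.starProjection_eq_self_iff.2 ?_
    exact mapsTo_spectralSubspace h B (Submodule.starProjection_apply_mem _ v)
  have h2 := congrArg star h1
  have h3 : star e = e := (isStarProjection_spectralProj x B).isSelfAdjoint.star_eq
  simp only [star_mul, h3, hy.star_eq] at h2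
  change e * y = y * e
  rw [← h2, ← mul_assoc, h1]

theorem commute_spectralProj_spectralProj {x y : H →L[ℂ] H} (h : Commute x y)
    (hx : IsSelfAdjoint x) (B C : Set ℝ) : Commute (spectralProj x B) (spectralProj y C) :=
  (commute_spectralProj (commute_spectralProj h.symm hx C).symm
    (isStarProjection_spectralProj y C).isSelfAdjoint B)

/-- The positive part `(t - a)⁺`. -/
def posPartSub (a t : ℝ) : ℝ := max (t - a) 0

theorem continuous_posPartSub (a : ℝ) : Continuous (posPartSub a) := by
  unfold posPartSub
  fun_prop

theorem posPartSub_nonneg (a t : ℝ) : 0 ≤ posPartSub a t := le_max_right _ _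

theorem posPartSub_eq_zero_iff (a t : ℝ) : posPartSub a t = 0 ↔ t ∉ Set.Ioi a := by
  simp [posPartSub]

theorem spectralProj_Ioi_apply_eq_zero_iff (x : H →L[ℂ] H) (a : ℝ) (v : H) :
    spectralProj x (Set.Ioi a) v = 0 ↔ cfc (posPartSub a) x v = 0 :=
  spectralProj_apply_eq_zero_iff isOpen_Ioi (continuous_posPartSub a) (posPartSub_nonneg a)
    (posPartSub_eq_zero_iff a) v

/-- An odd power is strictly increasing, so `(t^m - a^m)⁺` and `(t - a)⁺` have the same zeros. This
transfers symmetry from `x` to `x ^ m`. -/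
theorem spectralProj_Ioi_pow {x : H →L[ℂ] H} (hx : IsSelfAdjoint x) {m : ℕ} (hm : Odd m) (a : ℝ) :
    spectralProj (x ^ m) (Set.Ioi (a ^ m)) = spectralProj x (Set.Ioi a) := by
  refine eq_of_forall_apply_eq_zero_iff (isStarProjection_spectralProj _ _)
    (isStarProjection_spectralProj _ _) fun v => ?_
  rw [spectralProj_Ioi_apply_eq_zero_iff _]
  have h1 : cfc (posPartSub (a ^ m)) (x ^ m) = cfc (fun t => posPartSub (a ^ m) (t ^ m)) x := by
    rw [← cfc_comp_pow (posPartSub (a ^ m)) m x (continuous_posPartSub _).continuousOn hx]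
  rw [h1]
  refine (spectralProj_apply_eq_zero_iff isOpen_Ioi
    ((continuous_posPartSub _).comp (continuous_pow m)) (fun t => posPartSub_nonneg _ _)
    (fun t => ?_) v).symm
  simp only [Function.comp, posPartSub_eq_zero_iff, Set.mem_Ioi, hm.strictMono_pow.lt_iff_lt]

theorem spectralProj_zero_Ioi {a : ℝ} (ha : 0 ≤ a) :
    spectralProj (0 : H →L[ℂ] H) (Set.Ioi a) = 0 := by
  ext v
  refine (spectralProj_Ioi_apply_eq_zero_iff _ a v).2 ?_
  rw [cfc_apply_zero]
  simp [posPartSub, ha]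

theorem spectralProj_Ioi_mul_neg {x : H →L[ℂ] H} (hx : IsSelfAdjoint x) {a : ℝ} (ha : 0 ≤ a) :
    spectralProj x (Set.Ioi a) * spectralProj (-x) (Set.Ioi a) = 0 := by
  have h1 : cfc (posPartSub a) (-x) * spectralProj x (Set.Ioi a) = 0 := by
    rw [← cfc_comp_neg (posPartSub a) x (continuous_posPartSub a).continuousOn hx]
    refine cfc_mul_spectralProj_eq_zero x isOpen_Ioi
      ((continuous_posPartSub a).comp continuous_neg) fun t ht => ?_
    simp only [Set.mem_Ioi] at ht
    simp only [posPartSub_eq_zero_iff, Set.mem_Ioi]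
    linarith
  have h2 : spectralProj (-x) (Set.Ioi a) * spectralProj x (Set.Ioi a) = 0 := by
    ext v
    refine (spectralProj_Ioi_apply_eq_zero_iff _ a _).2 ?_
    exact congrArg (fun T : H →L[ℂ] H => T v) h1
  rw [(commute_spectralProj_spectralProj (Commute.neg_right (Commute.refl x)) hx _ _).eq, h2]

/-- `(|t| - a)⁺ = (t - a)⁺ + (-t - a)⁺`, and the two terms live on orthogonal projections, so the
sum kills a vector iff each term does. -/
theorem spectralProj_abs_Ioi {x : H →L[ℂ] H} (hx : IsSelfAdjoint x) {a : ℝ} (ha : 0 < a) :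
    spectralProj (CFC.abs x) (Set.Ioi a)
      = spectralProj x (Set.Ioi a) + spectralProj (-x) (Set.Ioi a) := by
  have h0 := spectralProj_Ioi_mul_neg hx ha.le
  have e1 := isStarProjection_spectralProj x (Set.Ioi a)
  have e2 := isStarProjection_spectralProj (-x) (Set.Ioi a)
  refine eq_of_forall_apply_eq_zero_iff (isStarProjection_spectralProj _ _)
    (e1.add e2 h0) fun v => ?_
  have habs : cfc (posPartSub a) (CFC.abs x)
      = cfc (posPartSub a) x + cfc (posPartSub a) (-x) := by
    rw [CFC.abs_eq_cfc_norm x hx, ← cfc_comp_neg (posPartSub a) x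
      (continuous_posPartSub a).continuousOn hx, ← cfc_add x (posPartSub a) (fun t => posPartSub a (-t))
      (continuous_posPartSub a).continuousOn
      ((continuous_posPartSub a).comp continuous_neg).continuousOn,
      ← cfc_comp (posPartSub a) (fun t : ℝ => ‖t‖) x hx (continuous_posPartSub a).continuousOn
        continuous_norm.continuousOn]
    congr 1
    funext t
    simp only [Function.comp, posPartSub, Real.norm_eq_abs]
    rcases le_total 0 t with h | h
    · rw [abs_of_nonneg h, max_eq_right (a := -t - a) (by linarith), add_zero]
    · rw [abs_of_nonpos h, max_eq_right (a := t - a) (by linarith), zero_add]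
  rw [spectralProj_Ioi_apply_eq_zero_iff _, habs]
  constructor
  · intro h
    have p1 : cfc (posPartSub a) x * spectralProj (-x) (Set.Ioi a) = 0 := by
      rw [← cfc_mul_spectralProj x isOpen_Ioi (continuous_posPartSub a)
        fun t ht => (posPartSub_eq_zero_iff a t).2 ht, mul_assoc, h0, mul_zero]
    have q1 : spectralProj x (Set.Ioi a) * cfc (posPartSub a) (-x) = 0 := by
      rw [← spectralProj_mul_cfc (-x) isOpen_Ioi (continuous_posPartSub a)
        fun t ht => (posPartSub_eq_zero_iff a t).2 ht, ← mul_assoc, h0, zero_mul]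
    have k1 : cfc (posPartSub a) x v = 0 := by
      have := congrArg (spectralProj x (Set.Ioi a)) h
      rw [add_apply, map_add, map_zero] at this
      rw [show spectralProj x (Set.Ioi a) (cfc (posPartSub a) (-x) v) = 0 from
        congrArg (fun T : H →L[ℂ] H => T v) q1, add_zero] at this
      rwa [show spectralProj x (Set.Ioi a) (cfc (posPartSub a) x v) = cfc (posPartSub a) x v from
        congrArg (fun T : H →L[ℂ] H => T v) (spectralProj_mul_cfc x isOpen_Ioi
          (continuous_posPartSub a) fun t ht => (posPartSub_eq_zero_iff a t).2 ht)] at this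
    have k2 : cfc (posPartSub a) (-x) v = 0 := by simpa [k1] using h
    rw [add_apply, (spectralProj_Ioi_apply_eq_zero_iff _ a v).2 k1,
      (spectralProj_Ioi_apply_eq_zero_iff _ a v).2 k2, add_zero]
  · intro h
    have k1 : spectralProj x (Set.Ioi a) v = 0 := by
      have := congrArg (spectralProj x (Set.Ioi a)) h
      rw [add_apply, map_add, map_zero] at this
      rwa [show spectralProj x (Set.Ioi a) (spectralProj (-x) (Set.Ioi a) v) = 0 from
        congrArg (fun T : H →L[ℂ] H => T v) h0, add_zero,
        show spectralProj x (Set.Ioi a) (spectralProj x (Set.Ioi a) v)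
          = spectralProj x (Set.Ioi a) v from
        congrArg (fun T : H →L[ℂ] H => T v) e1.isIdempotentElem.eq] at this
    have k2 : spectralProj (-x) (Set.Ioi a) v = 0 := by simpa [k1] using h
    rw [add_apply, (spectralProj_Ioi_apply_eq_zero_iff _ a v).1 k1,
      (spectralProj_Ioi_apply_eq_zero_iff _ a v).1 k2, add_zero]

/-- If `s > a` and `t ≥ 0`, then `s + t > a`, for commuting self-adjoint operators. -/
theorem spectralProj_mul_one_sub_mul_one_sub {s t : H →L[ℂ] H} (hs : IsSelfAdjoint s)
    (ht : IsSelfAdjoint t) (hst : Commute s t) (a : ℝ) :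
    spectralProj s (Set.Ioi a) * (1 - spectralProj (-t) (Set.Ioi 0)) *
      (1 - spectralProj (s + t) (Set.Ioi a)) = 0 := by
  have hsu : Commute s (s + t) := (Commute.refl s).add_right hst
  have htu : Commute (-t) (s + t) := (hst.symm.add_right (Commute.refl t)).neg_left
  have hE := isStarProjection_spectralProj s (Set.Ioi a)
  have hF := isStarProjection_spectralProj (-t) (Set.Ioi 0)
  have hG := isStarProjection_spectralProj (s + t) (Set.Ioi a)
  have cEF := commute_spectralProj_spectralProj hst.neg_right hs (Set.Ioi a) (Set.Ioi 0)
  have cEG := commute_spectralProj_spectralProj hsu hs (Set.Ioi a) (Set.Ioi a)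
  have cFG := commute_spectralProj_spectralProj htu ht.neg (Set.Ioi 0) (Set.Ioi a)
  set E := spectralProj s (Set.Ioi a) with hEd
  set F := spectralProj (-t) (Set.Ioi 0) with hFd
  set G := spectralProj (s + t) (Set.Ioi a) with hGd
  ext v
  -- Spectrally, `w` sees `s > a`, `t ≥ 0` and `s + t ≤ a`; the aim is `w = 0`.
  set w := (E * (1 - F) * (1 - G)) v with hw
  have hE1 : E * (E * (1 - F) * (1 - G)) = E * (1 - F) * (1 - G) := by
    rw [← mul_assoc, ← mul_assoc, hE.isIdempotentElem.eq]
  have hF1 : F * (E * (1 - F) * (1 - G)) = 0 := by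
    rw [← mul_assoc, ← mul_assoc, cEF.symm.eq, mul_assoc E F, hF.mul_one_sub_self, mul_zero, zero_mul]
  have hG1 : G * (E * (1 - F) * (1 - G)) = 0 := by
    have c1 : Commute G (E * (1 - F)) :=
      cEG.symm.mul_right ((Commute.one_right G).sub_right cFG.symm)
    rw [← mul_assoc, c1.eq, mul_assoc, hG.mul_one_sub_self, mul_zero]
  have hEw : E w = w := congrArg (fun T : H →L[ℂ] H => T v) hE1
  have hFw : F w = 0 := congrArg (fun T : H →L[ℂ] H => T v) hF1
  have hGw : G w = 0 := congrArg (fun T : H →L[ℂ] H => T v) hG1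
  -- `x - a = (x - a)⁺ - (x - a)⁻` on vectors
  have key : ∀ (x : H →L[ℂ] H), IsSelfAdjoint x → ∀ b : ℝ,
      (cfc (posPartSub b) x : H →L[ℂ] H) w
        = x w - (b : ℂ) • w + (cfc (fun r => posPartSub (-b) (-r)) x : H →L[ℂ] H) w := by
    intro x hx b
    have h1 : cfc (posPartSub b) x
        = (x - algebraMap ℝ _ b) + cfc (fun r => posPartSub (-b) (-r)) x := by
      have h2 : cfc (fun r : ℝ => r - b) x = x - algebraMap ℝ _ b := by
        rw [cfc_sub (fun r : ℝ => r) (fun _ => b) x, cfc_id' ℝ x, cfc_const b x]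
      rw [← h2, ← cfc_add x (fun r : ℝ => r - b) (fun r => posPartSub (-b) (-r)) (by fun_prop)
        ((continuous_posPartSub _).comp continuous_neg).continuousOn]
      congr 1
      funext r
      simp only [posPartSub]
      rcases le_total r b with h | h
      · rw [max_eq_right (by linarith), max_eq_left (by linarith)]; ring
      · rw [max_eq_left (by linarith), max_eq_right (by linarith)]; ring
    rw [h1]
    simp [Algebra.algebraMap_eq_smul_one]
  have pos : ∀ (x : H →L[ℂ] H) (f : ℝ → ℝ), (∀ r, 0 ≤ f r) →
      0 ≤ (inner ℂ (cfc f x w) w).re := fun x f hf =>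
    ((ContinuousLinearMap.nonneg_iff_isPositive (cfc f x)).1
      (cfc_nonneg fun r _ => hf r)).re_inner_nonneg_left w
  have hs1 : (cfc (fun r => posPartSub (-a) (-r)) s : H →L[ℂ] H) w = 0 := by
    have h1 : cfc (fun r => posPartSub (-a) (-r)) s * E = 0 := by
      refine cfc_mul_spectralProj_eq_zero s isOpen_Ioi
        ((continuous_posPartSub _).comp continuous_neg) fun r hr => ?_
      simp only [Set.mem_Ioi] at hr
      simp only [posPartSub_eq_zero_iff, Set.mem_Ioi]
      linarith
    rw [← hEw]
    exact congrArg (fun T : H →L[ℂ] H => T w) h1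
  have hs2 := key s hs a
  rw [hs1, add_zero] at hs2
  have ht2 := key (-t) ht.neg 0
  rw [(spectralProj_Ioi_apply_eq_zero_iff _ 0 w).1 hFw] at ht2
  have hu2 := key (s + t) (hs.add ht) a
  rw [(spectralProj_Ioi_apply_eq_zero_iff _ a w).1 hGw] at hu2
  -- On `w` these terms are `(s - a)w`, `tw` and `-(s + t - a)w`, which cancel. All three operators
  -- are positive, so each quadratic form vanishes at `w`.
  have hsum : (cfc (posPartSub a) s : H →L[ℂ] H) w
      + (cfc (fun r => posPartSub (-0) (-r)) (-t) : H →L[ℂ] H) w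
      + (cfc (fun r => posPartSub (-a) (-r)) (s + t) : H →L[ℂ] H) w = 0 := by
    have ht3 : (cfc (fun r => posPartSub (-0) (-r)) (-t) : H →L[ℂ] H) w = t w := by
      simp at ht2
      rw [neg_add_eq_zero.1 ht2.symm]
      simp
    rw [hs2, ht3]
    rw [add_apply] at hu2
    rw [hu2]
    abel
  have hre := congrArg (fun z : H => (inner ℂ z w).re) hsum
  simp only [inner_add_left, Complex.add_re, inner_zero_left, Complex.zero_re] at hre
  have i1 := pos s (posPartSub a) (posPartSub_nonneg a)
  have i2 := pos (-t) (fun r => posPartSub (-0) (-r)) fun r => posPartSub_nonneg _ _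
  have i3 := pos (s + t) (fun r => posPartSub (-a) (-r)) fun r => posPartSub_nonneg _ _
  have hz : (inner ℂ ((cfc (posPartSub a) s : H →L[ℂ] H) w) w).re = 0 := by linarith
  -- A positive operator whose form vanishes at `w` kills `w`, by its square root.
  have hsw : (cfc (posPartSub a) s : H →L[ℂ] H) w = 0 := by
    set r := cfc (fun r => Real.sqrt (posPartSub a r)) s with hr
    have hrc : Continuous fun r => Real.sqrt (posPartSub a r) :=
      Real.continuous_sqrt.comp (continuous_posPartSub a)
    have hrr : r * r = cfc (posPartSub a) s := by
      rw [hr, ← cfc_mul _ _ s hrc.continuousOn hrc.continuousOn]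
      congr 1
      funext u
      exact Real.mul_self_sqrt (posPartSub_nonneg a u)
    have hrs : IsSelfAdjoint r := cfc_predicate _ s
    have h1 : inner ℂ ((cfc (posPartSub a) s : H →L[ℂ] H) w) w = inner ℂ (r w) (r w) := by
      rw [← hrr]
      exact ContinuousLinearMap.isSelfAdjoint_iff_isSymmetric.1 hrs (r w) w
    rw [h1, inner_self_eq_norm_sq_to_K] at hz
    have h2 : ‖r w‖ ^ 2 = 0 := by exact_mod_cast hz
    have h3 : r w = 0 := by simpa using h2
    rw [← hrr]
    simp [h3]
  have : E w = 0 := (spectralProj_Ioi_apply_eq_zero_iff _ a w).2 hsw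
  rw [← hEw, this]
  rfl

end Spectral

end NCLevy
namespace NCLevy

/-! ### Traces, distributions and odd moments of self-adjoint elements. -/

section Trace

variable {H : Type*} [NormedAddCommGroup H] [InnerProductSpace ℂ H] [CompleteSpace H]

theorem cfc_mem (M : VonNeumannAlgebra H) {x : H →L[ℂ] H} (hx : x ∈ M) (f : ℝ → ℝ) :
    cfc f x ∈ M := by
  by_cases hsa : IsSelfAdjoint x
  · rw [← VonNeumannAlgebra.commutant_commutant M, VonNeumannAlgebra.mem_commutant_iff]
    intro y hy
    rw [VonNeumannAlgebra.mem_commutant_iff] at hy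
    exact (hsa.commute_cfc (hy x hx) f).symm.eq
  · rw [cfc_apply_of_not_predicate x hsa]
    exact zero_mem M

variable {M : VonNeumannAlgebra H}

/-- The continuous functional calculus `f(x)`, as an element of the von Neumann algebra
`M ∋ x`. -/
noncomputable def cfcM (f : ℝ → ℝ) (x : M.toStarSubalgebra) : M.toStarSubalgebra :=
  ⟨cfc f (x : H →L[ℂ] H), cfc_mem M x.2 f⟩

theorem coe_isSelfAdjoint {x : M.toStarSubalgebra} (hx : IsSelfAdjoint x) :
    IsSelfAdjoint (x : H →L[ℂ] H) :=
  congrArg Subtype.val hx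

theorem isStarProjection_eProj (B : Set ℝ) (x : M.toStarSubalgebra) :
    IsStarProjection (eProj B x) where
  isIdempotentElem := Subtype.ext (isStarProjection_spectralProj _ _).isIdempotentElem
  isSelfAdjoint := Subtype.ext (isStarProjection_spectralProj _ _).isSelfAdjoint

theorem commute_eProj_eProj {x y : M.toStarSubalgebra} (h : Commute x y) (hx : IsSelfAdjoint x)
    (B C : Set ℝ) : Commute (eProj B x) (eProj C y) :=
  Subtype.ext (commute_spectralProj_spectralProj (congrArg Subtype.val h.eq)
    (coe_isSelfAdjoint hx) B C).eq

theorem eProj_zero_Ioi {a : ℝ} (ha : 0 ≤ a) :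
    eProj (Set.Ioi a) (0 : M.toStarSubalgebra) = 0 :=
  Subtype.ext (spectralProj_zero_Ioi ha)

theorem eProj_Ioi_mul_neg {x : M.toStarSubalgebra} (hx : IsSelfAdjoint x) {a : ℝ} (ha : 0 ≤ a) :
    eProj (Set.Ioi a) x * eProj (Set.Ioi a) (-x) = 0 :=
  Subtype.ext (spectralProj_Ioi_mul_neg (coe_isSelfAdjoint hx) ha)

theorem eProj_absM_Ioi {x : M.toStarSubalgebra} (hx : IsSelfAdjoint x) {a : ℝ} (ha : 0 < a) :
    eProj (Set.Ioi a) (absM x) = eProj (Set.Ioi a) x + eProj (Set.Ioi a) (-x) :=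
  Subtype.ext (spectralProj_abs_Ioi (coe_isSelfAdjoint hx) ha)

theorem eProj_Ioi_pow {x : M.toStarSubalgebra} (hx : IsSelfAdjoint x) {m : ℕ} (hm : Odd m)
    (a : ℝ) : eProj (Set.Ioi (a ^ m)) (x ^ m) = eProj (Set.Ioi a) x :=
  Subtype.ext (spectralProj_Ioi_pow (coe_isSelfAdjoint hx) hm a)

theorem eProj_mul_one_sub_mul_one_sub {s t : M.toStarSubalgebra} (hs : IsSelfAdjoint s)
    (ht : IsSelfAdjoint t) (hst : Commute s t) (a : ℝ) :
    eProj (Set.Ioi a) s * (1 - eProj (Set.Ioi 0) (-t)) * (1 - eProj (Set.Ioi a) (s + t)) = 0 :=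
  Subtype.ext (spectralProj_mul_one_sub_mul_one_sub (coe_isSelfAdjoint hs) (coe_isSelfAdjoint ht)
    (congrArg Subtype.val hst.eq) a)

variable {τ : M.toStarSubalgebra →ₗ[ℂ] ℂ}

theorem tr_nonneg (hτ : IsNormalFaithfulTracialState τ) {a : M.toStarSubalgebra}
    (ha : 0 ≤ (a : H →L[ℂ] H)) : 0 ≤ (τ a).re ∧ (τ a).im = 0 := by
  have hsa : IsSelfAdjoint (a : H →L[ℂ] H) := ha.isSelfAdjoint
  have h1 : star (cfcM Real.sqrt a) * cfcM Real.sqrt a = a := by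
    refine Subtype.ext ?_
    change star (cfc Real.sqrt (a : H →L[ℂ] H)) * cfc Real.sqrt (a : H →L[ℂ] H) = a
    rw [(cfc_predicate Real.sqrt (a : H →L[ℂ] H) : IsSelfAdjoint _).star_eq,
      ← cfc_mul _ _ _ Real.continuous_sqrt.continuousOn Real.continuous_sqrt.continuousOn]
    conv_rhs => rw [← cfc_id' ℝ (a : H →L[ℂ] H)]
    exact cfc_congr fun t ht => Real.mul_self_sqrt (spectrum_nonneg_of_nonneg ha ht)
  have h2 := hτ.nonneg (cfcM Real.sqrt a)
  rw [h1, Complex.le_def] at h2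
  exact ⟨h2.1, h2.2.symm⟩

theorem tr_mono (hτ : IsNormalFaithfulTracialState τ) {a b : M.toStarSubalgebra}
    (hab : (a : H →L[ℂ] H) ≤ b) : (τ a).re ≤ (τ b).re := by
  have h := (tr_nonneg hτ (a := b - a) (sub_nonneg.2 hab)).1
  rw [map_sub, Complex.sub_re] at h
  linarith

theorem tr_projection_nonneg (hτ : IsNormalFaithfulTracialState τ) {p : M.toStarSubalgebra}
    (hp : IsStarProjection p) : 0 ≤ (τ p).re ∧ (τ p).im = 0 := by
  have h := hτ.nonneg p
  rw [hp.isSelfAdjoint.star_eq, hp.isIdempotentElem.eq, Complex.le_def] at h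
  exact ⟨h.1, h.2.symm⟩

theorem tr_smul_one (hτ : IsNormalFaithfulTracialState τ) (c : ℝ) :
    τ ((c : ℂ) • 1) = c := by
  rw [map_smul, hτ.map_one, smul_eq_mul, mul_one]

theorem coe_smul_one (c : ℝ) :
    (((c : ℂ) • (1 : M.toStarSubalgebra) : M.toStarSubalgebra) : H →L[ℂ] H)
      = algebraMap ℝ (H →L[ℂ] H) c := by
  rw [Algebra.algebraMap_eq_smul_one]
  ext v
  simp

theorem tr_re_le_norm (hτ : IsNormalFaithfulTracialState τ) {a : M.toStarSubalgebra}
    (ha : IsSelfAdjoint a) : (τ a).re ≤ ‖(a : H →L[ℂ] H)‖ := by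
  have h := tr_mono hτ (a := a) (b := ((‖(a : H →L[ℂ] H)‖ : ℝ) : ℂ) • 1)
    (by rw [coe_smul_one]; exact IsSelfAdjoint.le_algebraMap_norm_self (coe_isSelfAdjoint ha))
  rwa [tr_smul_one hτ, Complex.ofReal_re] at h

theorem abs_tr_re_le_norm (hτ : IsNormalFaithfulTracialState τ) {a : M.toStarSubalgebra}
    (ha : IsSelfAdjoint a) : |(τ a).re| ≤ ‖(a : H →L[ℂ] H)‖ := by
  refine abs_le'.2 ⟨tr_re_le_norm hτ ha, ?_⟩
  have h := tr_re_le_norm hτ ha.neg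
  rw [map_neg, Complex.neg_re] at h
  refine h.trans_eq ?_
  change ‖-(a : H →L[ℂ] H)‖ = _
  rw [norm_neg]

theorem tr_im_eq_zero (hτ : IsNormalFaithfulTracialState τ) {a : M.toStarSubalgebra}
    (ha : IsSelfAdjoint a) : (τ a).im = 0 := by
  have h := (tr_nonneg hτ (a := ((‖(a : H →L[ℂ] H)‖ : ℝ) : ℂ) • 1 - a) (by
    change 0 ≤ (((‖(a : H →L[ℂ] H)‖ : ℝ) : ℂ) • (1 : M.toStarSubalgebra) : M.toStarSubalgebra).1
      - a.1
    rw [coe_smul_one]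
    exact sub_nonneg.2 (IsSelfAdjoint.le_algebraMap_norm_self (coe_isSelfAdjoint ha)))).2
  rw [map_sub, tr_smul_one hτ] at h
  simpa using h

theorem isSelfAdjoint_cfcM (f : ℝ → ℝ) (x : M.toStarSubalgebra) : IsSelfAdjoint (cfcM f x) :=
  Subtype.ext (cfc_predicate f (x : H →L[ℂ] H) : IsSelfAdjoint (cfc f (x : H →L[ℂ] H)))

/-- The slopes of `a ↦ τ((x - a)⁺)` are bounded by the values of the distribution function. -/
theorem tr_posPart_sub_bounds (hτ : IsNormalFaithfulTracialState τ) {x : M.toStarSubalgebra}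
    (hx : IsSelfAdjoint x) (a : ℝ) {h : ℝ} (hh : 0 ≤ h) :
    h * (τ (eProj (Set.Ioi (a + h)) x)).re ≤
        (τ (cfcM (posPartSub a) x)).re - (τ (cfcM (posPartSub (a + h)) x)).re ∧
      (τ (cfcM (posPartSub a) x)).re - (τ (cfcM (posPartSub (a + h)) x)).re ≤
        h * (τ (eProj (Set.Ioi a) x)).re := by
  have hxs := coe_isSelfAdjoint hx
  -- `φ` climbs from `0` at `a` to `h` at `a + h`, so it lies between `h` times the indicators of
  -- `(a + h, ∞)` and `(a, ∞)`.
  set φ : ℝ → ℝ := fun t => posPartSub a t - posPartSub (a + h) t with hφ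
  have hφc : Continuous φ := (continuous_posPartSub a).sub (continuous_posPartSub _)
  have hφ0 : ∀ t, 0 ≤ φ t := fun t => by
    simp only [hφ, posPartSub, sub_nonneg]
    exact max_le_max (by linarith) le_rfl
  have hφh : ∀ t, φ t ≤ h := fun t => by
    simp only [hφ, posPartSub]
    rcases max_cases (t - a) 0 with h1 | h1 <;> rcases max_cases (t - (a + h)) 0 with h2 | h2 <;>
      linarith
  have hφa : ∀ t, t ∉ Set.Ioi a → φ t = 0 := fun t ht => by
    simp only [Set.mem_Ioi, not_lt] at ht
    simp only [hφ, posPartSub]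
    rw [max_eq_right (by linarith), max_eq_right (by linarith), sub_zero]
  have hφb : ∀ t ∈ Set.Ioi (a + h), h - φ t = 0 := fun t ht => by
    simp only [Set.mem_Ioi] at ht
    simp only [hφ, posPartSub]
    rw [max_eq_left (by linarith), max_eq_left (by linarith)]
    ring
  have hsplit : cfc φ (x : H →L[ℂ] H)
      = cfc (posPartSub a) (x : H →L[ℂ] H) - cfc (posPartSub (a + h)) (x : H →L[ℂ] H) :=
    cfc_sub _ _ _ (continuous_posPartSub _).continuousOn (continuous_posPartSub _).continuousOn
  have hcompl : cfc (fun t => h - φ t) (x : H →L[ℂ] H)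
      = (h : ℂ) • 1 - cfc φ (x : H →L[ℂ] H) := by
    rw [cfc_sub (fun _ => h) φ _ continuousOn_const hφc.continuousOn, cfc_const h _ hxs,
      Algebra.algebraMap_eq_smul_one]
    simp
  have htr : (τ (cfcM (posPartSub a) x)).re - (τ (cfcM (posPartSub (a + h)) x)).re
      = (τ (cfcM φ x)).re := by
    rw [← Complex.sub_re, ← map_sub]
    exact congrArg (fun z => (τ z).re) (Subtype.ext hsplit.symm)
  have hsm : ∀ p : M.toStarSubalgebra, h * (τ p).re = (τ ((h : ℂ) • p)).re := fun p => by
    simp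
  rw [htr, hsm, hsm]
  constructor
  · refine tr_mono hτ ?_
    change (h : ℂ) • spectralProj (x : H →L[ℂ] H) (Set.Ioi (a + h)) ≤ cfc φ (x : H →L[ℂ] H)
    have he := isStarProjection_spectralProj (x : H →L[ℂ] H) (Set.Ioi (a + h))
    have hcm : Commute (spectralProj (x : H →L[ℂ] H) (Set.Ioi (a + h)))
        (cfc φ (x : H →L[ℂ] H)) :=
      commute_spectralProj (hxs.commute_cfc (Commute.refl _) φ).symm (cfc_predicate φ _) _
    have h1 := cfc_mul_spectralProj_eq_zero (x : H →L[ℂ] H) (isOpen_Ioi (a := a + h))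
      (f := fun t => h - φ t) (continuous_const.sub hφc) hφb
    set e := spectralProj (x : H →L[ℂ] H) (Set.Ioi (a + h)) with hed
    rw [hcompl, sub_mul, smul_one_mul, sub_eq_zero] at h1
    rw [h1, ← sub_nonneg]
    have h2 : cfc φ (x : H →L[ℂ] H) - cfc φ (x : H →L[ℂ] H) * e
        = star (1 - e) * cfc φ (x : H →L[ℂ] H) * (1 - e) := by
      have hc2 : Commute (1 - e) (cfc φ (x : H →L[ℂ] H)) :=
        (Commute.one_left _).sub_left hcm
      rw [he.one_sub.isSelfAdjoint.star_eq, hc2.eq, mul_assoc,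
        he.one_sub.isIdempotentElem.eq, mul_sub, mul_one]
    rw [h2]
    exact star_left_conjugate_nonneg (cfc_nonneg fun t _ => hφ0 t) _
  · refine tr_mono hτ ?_
    change cfc φ (x : H →L[ℂ] H) ≤ (h : ℂ) • spectralProj (x : H →L[ℂ] H) (Set.Ioi a)
    have he := isStarProjection_spectralProj (x : H →L[ℂ] H) (Set.Ioi a)
    have h1 := cfc_mul_spectralProj (x : H →L[ℂ] H) (isOpen_Ioi (a := a)) hφc hφa
    have h1' := spectralProj_mul_cfc (x : H →L[ℂ] H) (isOpen_Ioi (a := a)) hφc hφa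
    set e := spectralProj (x : H →L[ℂ] H) (Set.Ioi a) with hed
    rw [← sub_nonneg]
    have h2 : (h : ℂ) • e - cfc φ (x : H →L[ℂ] H)
        = star e * cfc (fun t => h - φ t) (x : H →L[ℂ] H) * e := by
      rw [he.isSelfAdjoint.star_eq, hcompl, mul_sub, sub_mul, h1', h1, mul_smul_comm, mul_one,
        smul_mul_assoc, he.isIdempotentElem.eq]
    rw [h2]
    exact star_left_conjugate_nonneg (cfc_nonneg fun t _ => sub_nonneg.2 (hφh t)) _

/-- A discrete form of "two primitives of `-G` differ by a constant". Over `N` equal steps of `[a,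
c]` the errors telescope to `(c - a)(G a - G c) / N`, which tends to `0`. -/
theorem eq_of_slope_bounds {F₁ F₂ G : ℝ → ℝ}
    (h₁ : ∀ a h, 0 ≤ h → h * G (a + h) ≤ F₁ a - F₁ (a + h) ∧ F₁ a - F₁ (a + h) ≤ h * G a)
    (h₂ : ∀ a h, 0 ≤ h → h * G (a + h) ≤ F₂ a - F₂ (a + h) ∧ F₂ a - F₂ (a + h) ≤ h * G a)
    {a c : ℝ} (hac : a ≤ c) (hc : F₁ c = F₂ c) : F₁ a = F₂ a := by
  have step : ∀ h, 0 ≤ h → ∀ j : ℕ,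
      |(F₁ a - F₂ a) - (F₁ (a + j * h) - F₂ (a + j * h))| ≤ h * (G a - G (a + j * h)) := by
    intro h hh j
    induction j with
    | zero => simp
    | succ j ih =>
      have e : a + ((j + 1 : ℕ) : ℝ) * h = (a + j * h) + h := by push_cast; ring
      rw [e]
      have i1 := h₁ (a + j * h) h hh
      have i2 := h₂ (a + j * h) h hh
      rw [abs_le] at ih ⊢
      constructor <;> linarith [ih.1, ih.2, i1.1, i1.2, i2.1, i2.2]
  have bound : ∀ N : ℕ, (N : ℝ) * |F₁ a - F₂ a| ≤ (c - a) * (G a - G c) := by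
    intro N
    rcases Nat.eq_zero_or_pos N with rfl | hN
    · have := step (c - a) (by linarith) 1
      have h3 := (abs_nonneg _).trans this
      simp only [Nat.cast_one, one_mul, add_sub_cancel] at h3
      simpa using h3
    · have hN' : (0 : ℝ) < N := by exact_mod_cast hN
      have h3 := step ((c - a) / N) (div_nonneg (by linarith) hN'.le) N
      have e : a + N * ((c - a) / N) = c := by field_simp; ring
      rw [e, hc, sub_self, sub_zero] at h3
      calc (N : ℝ) * |F₁ a - F₂ a| ≤ N * ((c - a) / N * (G a - G c)) := by gcongr
        _ = _ := by field_simp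
  by_contra hne
  have hpos : 0 < |F₁ a - F₂ a| := abs_pos.2 (sub_ne_zero.2 hne)
  obtain ⟨N, hN⟩ := exists_nat_gt ((c - a) * (G a - G c) / |F₁ a - F₂ a|)
  rw [div_lt_iff₀ hpos] at hN
  exact absurd (bound N) (not_le.2 hN)

/-- The factor `‖1‖` is `1` unless `H` is zero; keeping it avoids assuming `H` nontrivial. -/
theorem abs_le_of_mem_spectrum (x : H →L[ℂ] H) {t : ℝ} (ht : t ∈ spectrum ℝ x) :
    |t| ≤ ‖x‖ * ‖(1 : H →L[ℂ] H)‖ :=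
  spectrum.norm_le_norm_mul_of_mem ht

theorem cfcM_posPartSub_norm (y : M.toStarSubalgebra) :
    cfcM (posPartSub (‖(y : H →L[ℂ] H)‖ * ‖(1 : H →L[ℂ] H)‖)) y = 0 := by
  refine Subtype.ext ?_
  change cfc _ (y : H →L[ℂ] H) = 0
  rw [← cfc_const_zero ℝ (y : H →L[ℂ] H)]
  refine cfc_congr fun t ht => ?_
  have := abs_le_of_mem_spectrum _ ht
  rw [abs_le] at this
  simp only [posPartSub_eq_zero_iff, Set.mem_Ioi, not_lt]
  exact this.2

theorem cfcM_posPartSub_neg_norm {y : M.toStarSubalgebra} (hy : IsSelfAdjoint y) :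
    cfcM (posPartSub (-(‖(y : H →L[ℂ] H)‖ * ‖(1 : H →L[ℂ] H)‖))) y
      = y + ((‖(y : H →L[ℂ] H)‖ * ‖(1 : H →L[ℂ] H)‖ : ℝ) : ℂ) • 1 := by
  refine Subtype.ext ?_
  have hys := coe_isSelfAdjoint hy
  change cfc _ (y : H →L[ℂ] H) = y.1 + (((_ : ℝ) : ℂ) • (1 : M.toStarSubalgebra)).1
  rw [coe_smul_one]
  set c := ‖(y : H →L[ℂ] H)‖ * ‖(1 : H →L[ℂ] H)‖ with hc
  have h1 : cfc (fun t : ℝ => t + c) (y : H →L[ℂ] H) = y.1 + algebraMap ℝ _ c := by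
    rw [cfc_add (y : H →L[ℂ] H) (fun t : ℝ => t) (fun _ => c), cfc_id' ℝ _ hys, cfc_const c _ hys]
  rw [← h1]
  refine cfc_congr fun t ht => ?_
  have := abs_le_of_mem_spectrum _ ht
  rw [← hc, abs_le] at this
  simp only [posPartSub, sub_neg_eq_add]
  exact max_eq_left (by linarith)

/-- With `c` bounding the spectrum, `a ↦ τ((y - a)⁺)` and its analogue for `-y` have the same slope
bounds and vanish at `c`. At `-c` they equal `τ(y) + c` and `-τ(y) + c`. -/
theorem tr_eq_of_distribution_eq (hτ : IsNormalFaithfulTracialState τ)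
    {y : M.toStarSubalgebra} (hy : IsSelfAdjoint y)
    (h : ∀ a, (τ (eProj (Set.Ioi a) y)).re = (τ (eProj (Set.Ioi a) (-y))).re) : τ y = 0 := by
  have hn : ‖((-y : M.toStarSubalgebra) : H →L[ℂ] H)‖ = ‖(y : H →L[ℂ] H)‖ :=
    norm_neg (y : H →L[ℂ] H)
  have c1 := cfcM_posPartSub_norm y
  have c2 := cfcM_posPartSub_norm (-y)
  have d1 := cfcM_posPartSub_neg_norm hy
  have d2 := cfcM_posPartSub_neg_norm hy.neg
  rw [hn] at c2 d2
  have hc0 : 0 ≤ ‖(y : H →L[ℂ] H)‖ * ‖(1 : H →L[ℂ] H)‖ := by positivity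
  have key := eq_of_slope_bounds (G := fun a => (τ (eProj (Set.Ioi a) y)).re)
    (F₁ := fun a => (τ (cfcM (posPartSub a) y)).re)
    (F₂ := fun a => (τ (cfcM (posPartSub a) (-y))).re)
    (fun a h hh => tr_posPart_sub_bounds hτ hy a hh)
    (fun a b hb => by
      have := tr_posPart_sub_bounds hτ hy.neg a hb
      rwa [← h, ← h] at this)
    (show -(‖(y : H →L[ℂ] H)‖ * ‖(1 : H →L[ℂ] H)‖) ≤ _ from by linarith)
    (show (τ (cfcM (posPartSub (‖(y : H →L[ℂ] H)‖ * ‖(1 : H →L[ℂ] H)‖)) y)).re = _ by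
      simp only [c1, c2])
  simp only [d1, d2, map_add, map_neg, Complex.add_re, Complex.neg_re] at key
  exact Complex.ext (by simp only [Complex.zero_re]; linarith) (tr_im_eq_zero hτ hy)

theorem exists_real_pow_eq_of_odd {m : ℕ} (hm : Odd m) (a : ℝ) : ∃ b : ℝ, b ^ m = a := by
  have hm0 : (m : ℝ) ≠ 0 := by exact_mod_cast hm.pos.ne'
  rcases le_total 0 a with h | h
  · refine ⟨a ^ (1 / (m : ℝ)), ?_⟩
    rw [← Real.rpow_natCast, ← Real.rpow_mul h, one_div, inv_mul_cancel₀ hm0, Real.rpow_one]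
  · refine ⟨-(-a) ^ (1 / (m : ℝ)), ?_⟩
    rw [hm.neg_pow, ← Real.rpow_natCast, ← Real.rpow_mul (neg_nonneg.2 h), one_div,
      inv_mul_cancel₀ hm0, Real.rpow_one, neg_neg]

theorem IsSymmetric.tr_odd_pow (hτ : IsNormalFaithfulTracialState τ) {x : M.toStarSubalgebra}
    (hx : IsSelfAdjoint x) (hs : IsSymmetric τ x) {m : ℕ} (hm : Odd m) : τ (x ^ m) = 0 := by
  refine tr_eq_of_distribution_eq hτ (hx.pow m) fun a => ?_
  obtain ⟨b, rfl⟩ := exists_real_pow_eq_of_odd hm a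
  have h1 := eProj_Ioi_pow hx hm b
  have h2 := eProj_Ioi_pow hx.neg hm b
  have h3 : (-x) ^ m = -x ^ m := hm.neg_pow x
  have h4 := congrArg Complex.re (hs _ (measurableSet_Ioi (a := b)))
  rw [← h1, ← h2, h3] at h4
  exact h4

/-- In each binomial term of odd total degree, one of the two exponents is odd. -/
theorem tr_odd_pow_add {u v : M.toStarSubalgebra} (huv : Commute u v)
    (hind : ∀ i j, τ (u ^ i * v ^ j) = τ (u ^ i) * τ (v ^ j))
    (hu : ∀ m, Odd m → τ (u ^ m) = 0) (hv : ∀ m, Odd m → τ (v ^ m) = 0) {m : ℕ} (hm : Odd m) :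
    τ ((u + v) ^ m) = 0 := by
  rw [huv.add_pow, map_sum]
  refine Finset.sum_eq_zero fun i hi => ?_
  rw [← nsmul_eq_mul', map_nsmul, hind]
  rcases Nat.even_or_odd i with h | h
  · rw [hv (m - i) (Nat.Odd.sub_even (by simpa [Nat.lt_succ_iff] using hi) hm h), mul_zero,
      smul_zero]
  · rw [hu i h, zero_mul, smul_zero]

theorem tr_cfcM_polynomial_neg {t : M.toStarSubalgebra} (ht : IsSelfAdjoint t)
    (hodd : ∀ m, Odd m → τ (t ^ m) = 0) (p : Polynomial ℝ) :
    τ (cfcM (fun s => p.eval s) t) = τ (cfcM (fun s => p.eval s) (-t)) := by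
  have hmono : ∀ (n : ℕ) (a : ℝ) (x : M.toStarSubalgebra), IsSelfAdjoint x →
      cfcM (fun s => (Polynomial.monomial n a).eval s) x = (a : ℂ) • x ^ n := by
    intro n a x hx
    refine Subtype.ext ?_
    change cfc _ (x : H →L[ℂ] H) = (a : ℂ) • (x : H →L[ℂ] H) ^ n
    simp only [Polynomial.eval_monomial]
    rw [cfc_const_mul a (fun s => s ^ n) _ (by fun_prop), cfc_pow_id _ n (coe_isSelfAdjoint hx)]
    simp
  induction p using Polynomial.induction_on' with
  | add p q hp hq =>
    have h : ∀ x : M.toStarSubalgebra, cfcM (fun s => (p + q).eval s) x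
        = cfcM (fun s => p.eval s) x + cfcM (fun s => q.eval s) x := fun x => by
      refine Subtype.ext ?_
      change cfc _ _ = cfc _ _ + cfc _ _
      rw [← cfc_add _ _ _ p.continuous.continuousOn q.continuous.continuousOn]
      simp only [Polynomial.eval_add]
    rw [h, h, map_add, map_add, hp, hq]
  | monomial n a =>
    rw [hmono n a t ht, hmono n a (-t) ht.neg, map_smul, map_smul]
    rcases Nat.even_or_odd n with h | h
    · rw [h.neg_pow]
    · rw [h.neg_pow, map_neg, hodd n h, neg_zero]

/-- Polynomials suffice by Weierstrass on an interval containing both spectra, since `|τ(a)| ≤ ‖a‖`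
for self-adjoint `a`. -/
theorem tr_cfcM_neg (hτ : IsNormalFaithfulTracialState τ) {t : M.toStarSubalgebra}
    (ht : IsSelfAdjoint t) (hodd : ∀ m, Odd m → τ (t ^ m) = 0) {f : ℝ → ℝ} (hf : Continuous f) :
    (τ (cfcM f t)).re = (τ (cfcM f (-t))).re := by
  set c := ‖(t : H →L[ℂ] H)‖ * ‖(1 : H →L[ℂ] H)‖ with hc
  have hn : ‖((-t : M.toStarSubalgebra) : H →L[ℂ] H)‖ = ‖(t : H →L[ℂ] H)‖ :=
    norm_neg (t : H →L[ℂ] H)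
  rw [← sub_eq_zero, ← abs_eq_zero]
  refine le_antisymm (le_of_forall_pos_le_add fun ε hε => ?_) (abs_nonneg _)
  obtain ⟨p, hp⟩ := exists_polynomial_near_of_continuousOn (-c) c f hf.continuousOn (ε / 2)
    (half_pos hε)
  have hb : ∀ x : M.toStarSubalgebra, ‖(x : H →L[ℂ] H)‖ = ‖(t : H →L[ℂ] H)‖ →
      |(τ (cfcM f x)).re - (τ (cfcM (fun s => p.eval s) x)).re| ≤ ε / 2 := by
    intro x hx
    have h1 := abs_tr_re_le_norm hτ
      ((isSelfAdjoint_cfcM f x).sub (isSelfAdjoint_cfcM (fun s => p.eval s) x))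
    rw [map_sub, Complex.sub_re] at h1
    refine h1.trans ?_
    change ‖cfc f (x : H →L[ℂ] H) - cfc (fun s => p.eval s) (x : H →L[ℂ] H)‖ ≤ _
    rw [← cfc_sub _ _ _ hf.continuousOn p.continuous.continuousOn]
    refine norm_cfc_le (half_pos hε).le fun s hs => ?_
    have h2 := abs_le_of_mem_spectrum _ hs
    rw [hx, ← hc] at h2
    rw [← norm_neg, neg_sub]
    exact (hp s (abs_le.1 h2)).le
  have h1 := hb t rfl
  have h2 := hb (-t) hn
  rw [← tr_cfcM_polynomial_neg ht hodd p] at h2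
  rw [abs_le] at h1 h2 ⊢
  constructor <;> linarith [h1.1, h1.2, h2.1, h2.2]

/-- Continuous functions increasing to the indicator function of `(0, ∞)`. -/
noncomputable def rampFun (n : ℕ) (s : ℝ) : ℝ := min 1 (n * posPartSub 0 s)

theorem continuous_rampFun (n : ℕ) : Continuous (rampFun n) :=
  continuous_const.min (continuous_const.mul (continuous_posPartSub 0))

theorem rampFun_nonneg (n : ℕ) (s : ℝ) : 0 ≤ rampFun n s :=
  le_min zero_le_one (mul_nonneg n.cast_nonneg (posPartSub_nonneg 0 s))

theorem rampFun_le_one (n : ℕ) (s : ℝ) : rampFun n s ≤ 1 := min_le_left _ _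

theorem rampFun_mono (s : ℝ) {m n : ℕ} (h : m ≤ n) : rampFun m s ≤ rampFun n s :=
  min_le_min le_rfl (mul_le_mul_of_nonneg_right (by exact_mod_cast h) (posPartSub_nonneg 0 s))

theorem rampFun_eq_zero (n : ℕ) (s : ℝ) (hs : s ∉ Set.Ioi (0 : ℝ)) : rampFun n s = 0 := by
  rw [rampFun, (posPartSub_eq_zero_iff 0 s).2 hs]
  simp

theorem one_sub_rampFun_mul_le {n : ℕ} (hn : 0 < n) (s : ℝ) :
    ‖(1 - rampFun n s) * posPartSub 0 s‖ ≤ 1 / n := by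
  have hn' : (0 : ℝ) < n := by exact_mod_cast hn
  have h0 := posPartSub_nonneg 0 s
  rw [Real.norm_of_nonneg (mul_nonneg (sub_nonneg.2 (rampFun_le_one n s)) h0)]
  rcases le_total 1 (n * posPartSub 0 s) with h | h
  · rw [rampFun, min_eq_left h]
    simp
  · rw [rampFun, min_eq_right h, le_div_iff₀ hn']
    nlinarith [mul_nonneg hn'.le h0]

theorem cfc_rampFun_le_spectralProj (x : H →L[ℂ] H) (hx : IsSelfAdjoint x) (n : ℕ) :
    cfc (rampFun n) x ≤ spectralProj x (Set.Ioi 0) := by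
  have he := isStarProjection_spectralProj x (Set.Ioi 0)
  have h1 := cfc_mul_spectralProj x isOpen_Ioi (continuous_rampFun n) (rampFun_eq_zero n)
  have h1' := spectralProj_mul_cfc x isOpen_Ioi (continuous_rampFun n) (rampFun_eq_zero n)
  set e := spectralProj x (Set.Ioi 0) with hed
  rw [← sub_nonneg]
  have h3 : cfc (fun s => 1 - rampFun n s) x = 1 - cfc (rampFun n) x := by
    rw [cfc_sub _ _ x continuousOn_const (continuous_rampFun n).continuousOn, cfc_const_one ℝ x]
  have h2 : e - cfc (rampFun n) x = star e * cfc (fun s => 1 - rampFun n s) x * e := by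
    rw [he.isSelfAdjoint.star_eq, h3, mul_sub, sub_mul, h1', h1, mul_one,
      he.isIdempotentElem.eq]
  rw [h2]
  exact star_left_conjugate_nonneg (cfc_nonneg fun t _ => sub_nonneg.2 (rampFun_le_one n t)) _

/-- The closed range of the self-adjoint `(x - a)⁺` is the orthogonal complement of its kernel,
which is the kernel of `E((a, ∞))`. -/
theorem spectralProj_Ioi_apply_mem_closure_range (x : H →L[ℂ] H) (a : ℝ) (v : H) :
    spectralProj x (Set.Ioi a) v ∈
      closure (Set.range (cfc (posPartSub a) x : H →L[ℂ] H)) := by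
  set G : H →L[ℂ] H := cfc (posPartSub a) x with hG
  have hGs : IsSelfAdjoint G := cfc_predicate _ x
  have h : spectralProj x (Set.Ioi a) v ∈ G.range.topologicalClosure := by
    rw [← Submodule.orthogonal_orthogonal_eq_closure, Submodule.mem_orthogonal]
    intro w hw
    have hw0 : G w = 0 := by
      refine ext_inner_left ℂ fun u => ?_
      have h1 : inner ℂ (G u) w = 0 := (Submodule.mem_orthogonal _ _).1 hw (G u) ⟨u, rfl⟩
      rw [inner_zero_right, ← h1]
      exact (ContinuousLinearMap.isSelfAdjoint_iff_isSymmetric.1 hGs u w).symm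
    have h2 := (spectralProj_Ioi_apply_eq_zero_iff x a w).2 hw0
    have h3 : inner ℂ (spectralProj x (Set.Ioi a) w) v
        = inner ℂ w (spectralProj x (Set.Ioi a) v) :=
      ContinuousLinearMap.isSelfAdjoint_iff_isSymmetric.1
        (isStarProjection_spectralProj x (Set.Ioi a)).isSelfAdjoint w v
    rw [← h3, h2, inner_zero_left]
  exact h

theorem tendsto_cfc_rampFun_apply (x : H →L[ℂ] H) (v : H) :
    Filter.Tendsto (fun n => (cfc (rampFun n) x : H →L[ℂ] H) v) Filter.atTop
      (nhds (spectralProj x (Set.Ioi 0) v)) := by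
  rw [Metric.tendsto_atTop]
  intro ε hε
  obtain ⟨_, ⟨u, rfl⟩, hu⟩ := Metric.mem_closure_iff.1
    (spectralProj_Ioi_apply_mem_closure_range x 0 v) (ε / 4) (by positivity)
  obtain ⟨N, hN⟩ := exists_nat_gt (2 * ‖u‖ / ε)
  refine ⟨N + 1, fun n hn => ?_⟩
  have hn0 : 0 < n := by omega
  have hn0' : (0 : ℝ) < n := by exact_mod_cast hn0
  have hnN : 2 * ‖u‖ / ε < n := hN.trans (by exact_mod_cast (by omega : N < n))
  set e := spectralProj x (Set.Ioi 0) with hed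
  set g : H →L[ℂ] H := cfc (posPartSub 0) x with hgd
  set f : H →L[ℂ] H := cfc (rampFun n) x with hfd
  have hfe : f * e = f :=
    cfc_mul_spectralProj x isOpen_Ioi (continuous_rampFun n) (rampFun_eq_zero n)
  have hfn : ‖f‖ ≤ 1 := norm_cfc_le zero_le_one fun t _ => by
    rw [Real.norm_of_nonneg (rampFun_nonneg n t)]
    exact rampFun_le_one n t
  have hfg : ‖g - f * g‖ ≤ 1 / n := by
    have h1 : cfc (fun t => (1 - rampFun n t) * posPartSub 0 t) x = g - f * g := by
      have h2 : (fun t => (1 - rampFun n t) * posPartSub 0 t)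
          = fun t => posPartSub 0 t - rampFun n t * posPartSub 0 t := by
        funext t
        ring
      rw [h2, cfc_sub (posPartSub 0) (fun t => rampFun n t * posPartSub 0 t) x (continuous_posPartSub 0).continuousOn
        (Continuous.continuousOn (by
          exact (continuous_rampFun n).mul (continuous_posPartSub 0))),
        cfc_mul _ _ x (continuous_rampFun n).continuousOn (continuous_posPartSub 0).continuousOn]
    rw [← h1]
    exact norm_cfc_le (by positivity) fun t _ => one_sub_rampFun_mul_le hn0 t
  have hfv : f v = f (e v) := (congrArg (fun T : H →L[ℂ] H => T v) hfe).symm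
  -- Here `e v` is approximated by `g u`, and `f` is nearly the identity on `g u` because `‖g - f g‖
  -- ≤ 1/n`.
  have hdec : f (e v) - e v = f (e v - g u) - (e v - g u) - (g - f * g) u := by
    simp only [map_sub, sub_apply, mul_apply_eq_comp]
    abel
  rw [dist_eq_norm] at hu ⊢
  rw [hfv, hdec]
  have b1 : ‖f (e v - g u)‖ ≤ ‖e v - g u‖ := by
    simpa using ContinuousLinearMap.le_of_opNorm_le f hfn (e v - g u)
  have b2 : ‖(g - f * g) u‖ ≤ 1 / n * ‖u‖ := ContinuousLinearMap.le_of_opNorm_le _ hfg u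
  have b3 : 1 / n * ‖u‖ < ε / 2 := by
    rw [div_lt_iff₀ hε] at hnN
    rw [one_div, inv_mul_lt_iff₀ hn0']
    linarith
  calc _ ≤ ‖f (e v - g u) - (e v - g u)‖ + ‖(g - f * g) u‖ := norm_sub_le _ _
    _ ≤ ‖f (e v - g u)‖ + ‖e v - g u‖ + ‖(g - f * g) u‖ := by gcongr; exact norm_sub_le _ _
    _ < ε := by linarith

/-- Order bounds survive strong limits. This makes the projection a supremum, the form in which
normality of `τ` applies. -/
theorem spectralProj_le_of_forall_cfc_rampFun_le (x : H →L[ℂ] H)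
    {b : H →L[ℂ] H} (hb : ∀ n, cfc (rampFun n) x ≤ b) : spectralProj x (Set.Ioi 0) ≤ b := by
  have he := isStarProjection_spectralProj x (Set.Ioi 0)
  have hlim : ∀ v, Filter.Tendsto (fun n => (cfc (rampFun n) x : H →L[ℂ] H) v) Filter.atTop
      (nhds (spectralProj x (Set.Ioi 0) v)) := tendsto_cfc_rampFun_apply x
  have hb0 : 0 ≤ b := (cfc_nonneg fun t _ => rampFun_nonneg 0 t).trans (hb 0)
  rw [ContinuousLinearMap.le_def]
  refine ⟨ContinuousLinearMap.isSelfAdjoint_iff_isSymmetric.1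
    (hb0.isSelfAdjoint.sub he.isSelfAdjoint), fun v => ?_⟩
  have h2 : ∀ n, 0 ≤ (b - cfc (rampFun n) x).reApplyInnerSelf v := fun n =>
    ((ContinuousLinearMap.le_def _ _).1 (hb n)).2 v
  refine ge_of_tendsto' (f := fun n => (b - cfc (rampFun n) x).reApplyInnerSelf v)
    (x := Filter.atTop) ?_ h2
  simp only [ContinuousLinearMap.reApplyInnerSelf_apply, sub_apply]
  exact (RCLike.continuous_re.tendsto _).comp
    ((tendsto_const_nhds.sub (hlim v)).inner tendsto_const_nhds)

theorem isLUB_eProj_Ioi_zero {x : M.toStarSubalgebra} (hx : IsSelfAdjoint x) :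
    IsLUB (Set.range fun n => cfcM (rampFun n) x) (eProj (Set.Ioi 0) x) := by
  constructor
  · rintro _ ⟨n, rfl⟩
    exact cfc_rampFun_le_spectralProj _ (coe_isSelfAdjoint hx) n
  · intro b hb
    exact spectralProj_le_of_forall_cfc_rampFun_le _
      fun n => hb ⟨n, rfl⟩

theorem isLUB_tr_cfcM_rampFun (hτ : IsNormalFaithfulTracialState τ) {x : M.toStarSubalgebra}
    (hx : IsSelfAdjoint x) :
    IsLUB (Set.range fun n => (τ (cfcM (rampFun n) x)).re) (τ (eProj (Set.Ioi 0) x)).re := by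
  have h := hτ.normal (Set.range fun n => cfcM (rampFun n) x) _ (Set.range_nonempty _)
    (by rintro _ ⟨n, rfl⟩; exact isSelfAdjoint_cfcM _ _)
    (by
      refine Monotone.directed_le ?_ |>.directedOn_range
      intro m n hmn
      exact cfc_mono (a := (x : H →L[ℂ] H)) (fun s _ => rampFun_mono s hmn)
        (continuous_rampFun m).continuousOn (continuous_rampFun n).continuousOn)
    (isLUB_eProj_Ioi_zero hx)
  rwa [← Set.range_comp] at h

/-- By normality the projections of `t` and `-t` have equal traces, being suprema of equal numbers;
they are orthogonal, so the traces sum to at most `1`. -/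
theorem tr_eProj_neg_le_half (hτ : IsNormalFaithfulTracialState τ) {t : M.toStarSubalgebra}
    (ht : IsSelfAdjoint t) (hodd : ∀ m, Odd m → τ (t ^ m) = 0) :
    (τ (eProj (Set.Ioi 0) (-t))).re ≤ 1 / 2 := by
  have h1 := isLUB_tr_cfcM_rampFun hτ ht
  have h2 := isLUB_tr_cfcM_rampFun hτ ht.neg
  simp only [tr_cfcM_neg hτ ht hodd (continuous_rampFun _)] at h1
  have h3 := h1.unique h2
  have h4 := (isStarProjection_eProj (Set.Ioi 0) t).add (isStarProjection_eProj (Set.Ioi 0) (-t))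
    (eProj_Ioi_mul_neg ht le_rfl)
  have h5 := (tr_projection_nonneg hτ h4.one_sub).1
  rw [map_sub, map_add, hτ.map_one, Complex.sub_re, Complex.add_re, Complex.one_re] at h5
  linarith

end Trace

end NCLevy
namespace NCLevy

/-! ### Complementary products of commuting projections. -/

section ComplProd

variable {R : Type*} [Ring R]

/-- The product `(1 - P₀) ⋯ (1 - P_{k-1})`. -/
def complProd (P : ℕ → R) : ℕ → R
  | 0 => 1
  | k + 1 => complProd P k * (1 - P k)

theorem complProd_succ (P : ℕ → R) (k : ℕ) :
    complProd P (k + 1) = complProd P k * (1 - P k) := rfl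

theorem commute_complProd {P : ℕ → R} {y : R} (h : ∀ j, Commute y (P j)) (k : ℕ) :
    Commute y (complProd P k) := by
  induction k with
  | zero => exact Commute.one_right y
  | succ k ih => exact ih.mul_right ((Commute.one_right y).sub_right (h k))

theorem isStarProjection_mul [StarRing R] {p q : R} (hp : IsStarProjection p)
    (hq : IsStarProjection q) (h : Commute p q) : IsStarProjection (p * q) where
  isIdempotentElem := hp.isIdempotentElem.mul_of_commute h hq.isIdempotentElem
  isSelfAdjoint := by
    rw [IsSelfAdjoint, star_mul, hp.isSelfAdjoint.star_eq, hq.isSelfAdjoint.star_eq, h.eq]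

theorem isStarProjection_complProd [StarRing R] {P : ℕ → R} (hP : ∀ j, IsStarProjection (P j))
    (hcomm : ∀ i j, Commute (P i) (P j)) (k : ℕ) : IsStarProjection (complProd P k) := by
  induction k with
  | zero => exact IsStarProjection.one R
  | succ k ih =>
    exact isStarProjection_mul ih (hP k).one_sub
      ((Commute.one_right _).sub_right (commute_complProd (hcomm k) k).symm)

/-- The factor `1 - P k` can be moved next to `P k`. Hence `1 - complProd P m` dominates every `P k`
with `k < m`. -/
theorem complProd_mul_eq_zero [StarRing R] {P : ℕ → R} (hP : ∀ j, IsStarProjection (P j))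
    (hcomm : ∀ i j, Commute (P i) (P j)) {k m : ℕ} (hkm : k < m) : complProd P m * P k = 0 := by
  induction m with
  | zero => omega
  | succ m ih =>
    rw [complProd_succ, mul_assoc]
    rcases Nat.lt_succ_iff_lt_or_eq.1 hkm with h | rfl
    · rw [((Commute.one_left _).sub_left (hcomm m k)).eq, ← mul_assoc, ih h, zero_mul]
    · rw [(hP k).one_sub_mul_self, mul_zero]

end ComplProd

/-! ### Lévy's inequality by first passage. -/

section Levy

variable {H : Type*} [NormedAddCommGroup H] [InnerProductSpace ℂ H] [CompleteSpace H]
  {M : VonNeumannAlgebra H} {τ : M.toStarSubalgebra →ₗ[ℂ] ℂ}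

theorem coe_complProd_mem {P : ℕ → M.toStarSubalgebra} (N : VonNeumannAlgebra H) {k : ℕ}
    (h : ∀ j < k, (P j : H →L[ℂ] H) ∈ N) :
    ((complProd P k : M.toStarSubalgebra) : H →L[ℂ] H) ∈ N := by
  induction k with
  | zero => exact one_mem N
  | succ k ih =>
    exact mul_mem (ih fun j hj => h j (by omega)) (sub_mem (one_mem N) (h k (by omega)))

/-- Lévy's inequality for commuting partial sums whose increments have vanishing odd moments. -/
theorem exists_projection_levy (hτ : IsNormalFaithfulTracialState τ) {n : ℕ}
    {s : ℕ → M.toStarSubalgebra} (hsa : ∀ k, IsSelfAdjoint (s k))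
    (hcomm : ∀ j k, Commute (s j) (s k)) {N N' : ℕ → VonNeumannAlgebra H}
    (hN : ∀ j k, j ≤ k → (s j : H →L[ℂ] H) ∈ N k)
    (hN' : ∀ k, k ≤ n → ((s n - s k : M.toStarSubalgebra) : H →L[ℂ] H) ∈ N' k)
    (hind : ∀ k, 1 ≤ k → k < n → ∀ a b : M.toStarSubalgebra, (a : H →L[ℂ] H) ∈ N k →
      (b : H →L[ℂ] H) ∈ N' k → τ (a * b) = τ a * τ b)
    (hodd : ∀ k, k ≤ n → ∀ m, Odd m → τ ((s n - s k) ^ m) = 0) (a : ℝ) :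
    ∃ p : M.toStarSubalgebra, IsStarProjection p ∧
      (∀ k, 1 ≤ k → k ≤ n → p * eProj (Set.Ioi a) (s k) = eProj (Set.Ioi a) (s k)) ∧
      (τ p).re ≤ 2 * (τ (eProj (Set.Ioi a) (s n))).re := by
  -- The index is shifted: `complProd P k * P k` is the event that the level `a` is first exceeded
  -- at time `k + 1`.
  set P : ℕ → M.toStarSubalgebra := fun k => eProj (Set.Ioi a) (s (k + 1)) with hPd
  set E : M.toStarSubalgebra := eProj (Set.Ioi a) (s n) with hEd
  have hP : ∀ j, IsStarProjection (P j) := fun j => isStarProjection_eProj _ _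
  have hE : IsStarProjection E := isStarProjection_eProj _ _
  have hPP : ∀ i j, Commute (P i) (P j) := fun i j =>
    commute_eProj_eProj (hcomm _ _) (hsa _) _ _
  have hEP : ∀ j, Commute E (P j) := fun j => commute_eProj_eProj (hcomm _ _) (hsa _) _ _
  have hQ := isStarProjection_complProd hP hPP
  have hEQ := commute_complProd hEP
  have step : ∀ k, k < n →
      (τ (complProd P k * P k)).re ≤ 2 * (τ (complProd P k * P k * E)).re := by
    intro k hk
    set u := s n - s (k + 1) with hu
    set F : M.toStarSubalgebra := eProj (Set.Ioi 0) (-u) with hFd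
    set r := complProd P k * P k with hr
    have husa : IsSelfAdjoint u := (hsa _).sub (hsa _)
    have hF : IsStarProjection F := isStarProjection_eProj _ _
    have hFP : ∀ j, Commute F (P j) := fun j =>
      commute_eProj_eProj ((hcomm _ _).sub_left (hcomm _ _)).neg_left husa.neg _ _
    have hFE : Commute F E :=
      commute_eProj_eProj ((hcomm _ _).sub_left (hcomm _ _)).neg_left husa.neg _ _
    have hrp : IsStarProjection r :=
      isStarProjection_mul (hQ k) (hP k) (commute_complProd (hPP k) k).symm
    have hrF : Commute r F := ((commute_complProd hFP k).mul_right (hFP k)).symm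
    have hrE : Commute r E := ((hEQ k).mul_right (hEP k)).symm
    have hF2 : (τ F).re ≤ 1 / 2 := tr_eProj_neg_le_half hτ husa (hodd (k + 1) hk)
    have hrFτ : τ (r * F) = τ r * τ F := by
      rcases Nat.lt_or_ge (k + 1) n with h | h
      · refine hind (k + 1) (by omega) h _ _ ?_ ?_
        · exact mul_mem (coe_complProd_mem _ fun j hj =>
            spectralProj_mem _ (hN (j + 1) (k + 1) (by omega)) _) (spectralProj_mem _ (hN (k + 1) (k + 1) le_rfl) _)
        · exact spectralProj_mem _ (neg_mem (hN' (k + 1) hk)) _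
      -- At the last time `hind` does not apply, but the remaining increment is zero.
      · have h0 : u = 0 := by
          rw [hu, show k + 1 = n by omega, sub_self]
        have hF0 : F = 0 := by
          rw [hFd, h0, neg_zero, eProj_zero_Ioi le_rfl]
        rw [hF0, mul_zero, map_zero, mul_zero]
    -- If `s_{k+1} > a` and the remaining increment is nonnegative, then `s_n > a`.
    have hz : r * (1 - F) * (1 - E) = 0 := by
      have h := eProj_mul_one_sub_mul_one_sub (hsa (k + 1)) husa
        ((hcomm (k + 1) n).sub_right (hcomm (k + 1) (k + 1))) a
      rw [hu, add_sub_cancel] at h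
      rw [hr, mul_assoc (complProd P k), mul_assoc (complProd P k), h, mul_zero]
    have hid : r - r * F = r * E - r * F * E := by
      have h : r * (1 - F) * (1 - E) = r - r * F - (r * E - r * F * E) := by noncomm_ring
      rw [h] at hz
      exact sub_eq_zero.1 hz
    have hrFE : IsStarProjection (r * F * E) :=
      isStarProjection_mul (isStarProjection_mul hrp hF hrF) hE (hrE.mul_left hFE)
    have t1 := tr_projection_nonneg hτ hrp
    have t2 := tr_projection_nonneg hτ hrFE
    have hid2 := congrArg (fun z => (τ z).re) hid
    simp only [map_sub, Complex.sub_re, hrFτ, Complex.mul_re, t1.2, zero_mul, sub_zero] at hid2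
    -- `τ(r)/2 ≤ τ(r)(1 - τ(F)) = τ(rE) - τ(rFE) ≤ τ(rE)`.
    nlinarith [mul_le_mul_of_nonneg_left hF2 t1.1, t2.1]
  have sum : ∀ m, m ≤ n →
      (τ (1 - complProd P m)).re ≤ 2 * (τ ((1 - complProd P m) * E)).re := by
    intro m
    induction m with
    | zero => intro _; simp [complProd]
    | succ m ih =>
      intro hm
      have e1 : 1 - complProd P (m + 1) = (1 - complProd P m) + complProd P m * P m := by
        rw [complProd_succ]
        noncomm_ring
      rw [e1, add_mul, map_add, map_add, Complex.add_re, Complex.add_re]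
      linarith [ih (by omega), step m (by omega)]
  -- The supremum of the spectral projections of `s_1, …, s_n`.
  refine ⟨1 - complProd P n, (hQ n).one_sub, fun k hk1 hkn => ?_, ?_⟩
  · obtain ⟨j, rfl⟩ : ∃ j, k = j + 1 := ⟨k - 1, by omega⟩
    have h : complProd P n * eProj (Set.Ioi a) (s (j + 1)) = 0 :=
      complProd_mul_eq_zero hP hPP (show j < n by omega)
    rw [sub_mul, one_mul, h, sub_zero]
  · have h1 := sum n le_rfl
    have h2 := (tr_projection_nonneg hτ (isStarProjection_mul (hQ n) hE (hEQ n).symm)).1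
    rw [sub_mul, one_mul, map_sub τ E, Complex.sub_re] at h1
    linarith

theorem tr_le_of_mul_eq (hτ : IsNormalFaithfulTracialState τ) {p e : M.toStarSubalgebra}
    (hp : IsStarProjection p) (he : IsStarProjection e) (h : p * e = e) :
    (τ e).re ≤ (τ p).re := by
  have h2 : e * p = e := by
    have := congrArg star h
    rwa [star_mul, hp.isSelfAdjoint.star_eq, he.isSelfAdjoint.star_eq] at this
  have h3 : p - e = p * (1 - e) := by rw [mul_sub, mul_one, h]
  have h4 : IsStarProjection (p * (1 - e)) :=
    isStarProjection_mul hp he.one_sub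
      ((Commute.one_right p).sub_right (show p * e = e * p by rw [h, h2]))
  have h5 := (tr_projection_nonneg hτ h4).1
  rw [← h3, map_sub, Complex.sub_re] at h5
  linarith

/-! ### Partial sums: commutation and odd moments. -/

section PartialSum

variable {n : ℕ} {x : Fin n → M.toStarSubalgebra}

theorem partialSum_zero (x : Fin n → M.toStarSubalgebra) : partialSum x 0 = 0 :=
  Finset.sum_eq_zero fun i hi => by simp at hi

theorem partialSum_succ (x : Fin n → M.toStarSubalgebra) (i : Fin n) :
    partialSum x ((i : ℕ) + 1) = partialSum x i + x i := by
  have h : (Finset.univ : Finset (Fin n)).filter (fun j : Fin n => (j : ℕ) + 1 ≤ (i : ℕ) + 1)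
      = insert i ((Finset.univ : Finset (Fin n)).filter
        (fun j : Fin n => (j : ℕ) + 1 ≤ (i : ℕ))) := by
    ext j
    simp only [Finset.mem_filter, Finset.mem_univ, true_and, Finset.mem_insert, Fin.ext_iff]
    omega
  rw [partialSum, h, Finset.sum_insert (by simp), add_comm]
  rfl

theorem partialSum_sub_partialSum (x : Fin n → M.toStarSubalgebra) (k : ℕ) :
    partialSum x n - partialSum x k
      = ∑ i ∈ (Finset.univ : Finset (Fin n)).filter (fun i : Fin n => ¬ (i : ℕ) + 1 ≤ k), x i := by
  have h : partialSum x n = ∑ i, x i :=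
    Finset.sum_congr (Finset.filter_true_of_mem fun i _ => i.2) fun _ _ => rfl
  rw [sub_eq_iff_eq_add', h]
  exact (Finset.sum_filter_add_sum_filter_not _ _ _).symm

theorem coe_sum_mem (N : VonNeumannAlgebra H) (S : Finset (Fin n))
    (h : ∀ i ∈ S, (x i : H →L[ℂ] H) ∈ N) :
    ((∑ i ∈ S, x i : M.toStarSubalgebra) : H →L[ℂ] H) ∈ N := by
  have e : ((∑ i ∈ S, x i : M.toStarSubalgebra) : H →L[ℂ] H) = ∑ i ∈ S, (x i : H →L[ℂ] H) :=
    AddSubmonoidClass.coe_finsetSum _ _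
  rw [e]
  exact sum_mem h

/-- `W*(x₁, …, x_k)`. -/
noncomputable def wStarHead (x : Fin n → M.toStarSubalgebra) (k : ℕ) : VonNeumannAlgebra H :=
  wStar {y | ∃ i : Fin n, (i : ℕ) + 1 < k + 1 ∧ (x i : H →L[ℂ] H) = y}

/-- `W*(x_{k+1}, …, xₙ)`. -/
noncomputable def wStarTail (x : Fin n → M.toStarSubalgebra) (k : ℕ) : VonNeumannAlgebra H :=
  wStar {y | ∃ i : Fin n, k + 1 ≤ (i : ℕ) + 1 ∧ (x i : H →L[ℂ] H) = y}

theorem mem_wStarHead {k : ℕ} {i : Fin n} (h : (i : ℕ) < k) :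
    (x i : H →L[ℂ] H) ∈ wStarHead x k :=
  (wStar_le_iff _ _).1 le_rfl ⟨i, by omega, rfl⟩

theorem mem_wStarTail {k : ℕ} {i : Fin n} (h : k ≤ (i : ℕ)) :
    (x i : H →L[ℂ] H) ∈ wStarTail x k :=
  (wStar_le_iff _ _).1 le_rfl ⟨i, by omega, rfl⟩

theorem partialSum_mem_wStarHead {j k : ℕ} (h : j ≤ k) :
    (partialSum x j : H →L[ℂ] H) ∈ wStarHead x k :=
  coe_sum_mem _ _ fun i hi => mem_wStarHead (by
    have := (Finset.mem_filter.1 hi).2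
    omega)

theorem sub_partialSum_mem_wStarTail (x : Fin n → M.toStarSubalgebra) (k : ℕ) :
    ((partialSum x n - partialSum x k : M.toStarSubalgebra) : H →L[ℂ] H) ∈ wStarTail x k := by
  rw [partialSum_sub_partialSum]
  exact coe_sum_mem _ _ fun i hi => mem_wStarTail (by
    have := (Finset.mem_filter.1 hi).2
    omega)

theorem WeaklyFullyIndependent.map_mul (hind : WeaklyFullyIndependent τ x) {k : ℕ} (h1 : 1 ≤ k)
    (hk : k < n) {a b : M.toStarSubalgebra} (ha : (a : H →L[ℂ] H) ∈ wStarHead x k)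
    (hb : (b : H →L[ℂ] H) ∈ wStarTail x k) : τ (a * b) = τ a * τ b :=
  hind (k + 1) (by omega) hk a b ha hb

theorem isSelfAdjoint_partialSum (hsa : ∀ i, IsSelfAdjoint (x i)) (k : ℕ) :
    IsSelfAdjoint (partialSum x k) :=
  isSelfAdjoint_sum _ fun i _ => hsa i

/-- The total sum is central in the von Neumann algebra generated by the `xᵢ`. -/
theorem commute_partialSum_total
    (hcomm : ∀ k : ℕ, 1 ≤ k → k ≤ n →
      partialSum x k * partialSum x n = partialSum x n * partialSum x k) (i : Fin n) :
    Commute (partialSum x n) (x i) := by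
  have h : ∀ k, k ≤ n → Commute (partialSum x n) (partialSum x k) := by
    intro k hk
    rcases Nat.eq_zero_or_pos k with rfl | h1
    · rw [partialSum_zero]
      exact Commute.zero_right _
    · exact (hcomm k h1 hk).symm
  rw [← add_sub_cancel_left (partialSum x i) (x i), ← partialSum_succ]
  exact (h _ i.2).sub_right (h _ i.2.le)

/-- The conditional expectation of the central element `sₙ` onto `W*(x₁, …, x_k)` is `s_k` up to
a constant, so `s_k` is central in `W*(x₁, …, x_k)`. -/
theorem commute_partialSum_of_lt (hτ : IsNormalFaithfulTracialState τ)
    (hind : WeaklyFullyIndependent τ x)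
    (hcomm : ∀ k : ℕ, 1 ≤ k → k ≤ n →
      partialSum x k * partialSum x n = partialSum x n * partialSum x k)
    {k : ℕ} (hk : k ≤ n) {i : Fin n} (hi : (i : ℕ) < k) :
    Commute (partialSum x k) (x i) := by
  rcases hk.eq_or_lt with rfl | hkn
  · exact commute_partialSum_total hcomm i
  set z := partialSum x k with hz
  set w := partialSum x n - partialSum x k with hw
  set a := x i with ha
  set d := z * a - a * z with hd
  have hza : (z : H →L[ℂ] H) ∈ wStarHead x k := partialSum_mem_wStarHead le_rfl
  have haN : (a : H →L[ℂ] H) ∈ wStarHead x k := mem_wStarHead hi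
  have hdN : (d : H →L[ℂ] H) ∈ wStarHead x k :=
    sub_mem (mul_mem hza haN) (mul_mem haN hza)
  -- `z + w` is the total sum, which commutes with `a`.
  have hdw : d = a * w - w * a := by
    have h : (z + w) * a = a * (z + w) := by
      rw [hz, hw, add_sub_cancel]
      exact (commute_partialSum_total hcomm i).eq
    rw [add_mul, mul_add] at h
    rw [hd, sub_eq_sub_iff_add_eq_add, h, add_comm]
  have hwN : (w : H →L[ℂ] H) ∈ wStarTail x k := sub_partialSum_mem_wStarTail x k
  have hbN : ((star d : M.toStarSubalgebra) : H →L[ℂ] H) ∈ wStarHead x k := star_mem hdN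
  -- `star d` and `a` lie in the head algebra and `w` in the tail, so after cycling under the trace
  -- both orders of `a` and `w` give `τ(d* a) τ(w)`.
  have hzero : τ (star d * d) = 0 := by
    have e1 : τ (star d * (a * w)) = τ (star d * a) * τ w := by
      rw [← mul_assoc]
      exact hind.map_mul (by omega) hkn (mul_mem hbN haN) hwN
    have e2 : τ (star d * (w * a)) = τ (star d * a) * τ w := by
      rw [← mul_assoc, hτ.tracial, ← mul_assoc, hτ.tracial (star d) a]
      exact hind.map_mul (by omega) hkn (mul_mem haN hbN) hwN
    have e3 : star d * d = star d * (a * w) - star d * (w * a) := by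
      rw [← mul_sub, ← hdw]
    rw [e3, map_sub, e1, e2, sub_self]
  exact sub_eq_zero.1 (hτ.faithful d hzero)

/-- For `i < j`, `x j` is the difference of two consecutive partial sums, both commuting with `x i`.
-/
theorem commute_of_weaklyFullyIndependent (hτ : IsNormalFaithfulTracialState τ)
    (hind : WeaklyFullyIndependent τ x)
    (hcomm : ∀ k : ℕ, 1 ≤ k → k ≤ n →
      partialSum x k * partialSum x n = partialSum x n * partialSum x k) (i j : Fin n) :
    Commute (x i) (x j) := by
  have key : ∀ i j : Fin n, i < j → Commute (x j) (x i) := by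
    intro i j hij
    have hij' : (i : ℕ) < j := hij
    rw [← add_sub_cancel_left (partialSum x j) (x j), ← partialSum_succ]
    exact (commute_partialSum_of_lt hτ hind hcomm j.2 (by omega)).sub_left
      (commute_partialSum_of_lt hτ hind hcomm j.2.le hij')
  rcases lt_trichotomy i j with h | rfl | h
  · exact (key i j h).symm
  · exact Commute.refl _
  · exact key j i h

/-- Backward induction on `k`: each step adds one symmetric summand independent of the tail already
treated. -/
theorem tr_odd_pow_sub_partialSum (hτ : IsNormalFaithfulTracialState τ)
    (hsa : ∀ i, IsSelfAdjoint (x i)) (hind : WeaklyFullyIndependent τ x)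
    (hsymm : ∀ i, IsSymmetric τ (x i)) (hx : ∀ i j, Commute (x i) (x j)) {k : ℕ} (hk : k ≤ n) :
    ∀ m, Odd m → τ ((partialSum x n - partialSum x k) ^ m) = 0 := by
  induction hk using Nat.decreasingInduction with
  | self =>
    intro m hm
    rw [sub_self, zero_pow hm.pos.ne', map_zero]
  | of_succ k hk ih =>
    intro m hm
    have hsplit : partialSum x n - partialSum x k
        = x ⟨k, hk⟩ + (partialSum x n - partialSum x (k + 1)) := by
      have h := partialSum_succ x ⟨k, hk⟩
      simp only at h
      rw [h]
      abel
    rw [hsplit]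
    refine tr_odd_pow_add ?_ ?_ (fun m hm => (hsymm _).tr_odd_pow hτ (hsa _) hm) ih hm
    · rw [partialSum_sub_partialSum]
      exact Commute.sum_right _ _ _ fun j _ => hx _ _
    · intro i j
      rcases Nat.lt_or_ge (k + 1) n with h | h
      · exact hind.map_mul (k := k + 1) (by omega) h
          (pow_mem (mem_wStarHead (x := x) (i := ⟨k, hk⟩) (Nat.lt_succ_self k)) i)
          (pow_mem (sub_partialSum_mem_wStarTail x (k + 1)) j)
      -- The tail is empty, so the factorization is checked directly, with `0 ^ 0 = 1` and `τ 1 =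
      -- 1`.
      · rw [show k + 1 = n by omega, sub_self]
        rcases Nat.eq_zero_or_pos j with rfl | hj
        · rw [pow_zero, mul_one, hτ.map_one, mul_one]
        · rw [zero_pow hj.ne', mul_zero, map_zero, mul_zero]

end PartialSum

end Levy

end NCLevy

/-! ### The two-sided inequality. -/

theorem theorem2p4 {H : Type*} [NormedAddCommGroup H] [InnerProductSpace ℂ H] [CompleteSpace H]
    (M : VonNeumannAlgebra H) (τ : M.toStarSubalgebra →ₗ[ℂ] ℂ)
    (hτ : NCLevy.IsNormalFaithfulTracialState τ)
    (n : ℕ) (x : Fin n → M.toStarSubalgebra)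
    (hsa : ∀ i, IsSelfAdjoint (x i))
    (hind : NCLevy.WeaklyFullyIndependent τ x)
    (hsymm : ∀ i, NCLevy.IsSymmetric τ (x i))
    (hcomm : ∀ k : ℕ, 1 ≤ k → k ≤ n →
      NCLevy.partialSum x k * NCLevy.partialSum x n =
        NCLevy.partialSum x n * NCLevy.partialSum x k)
    (lam : ℝ) (hlam : 0 < lam) :
    ∃ p q : M.toStarSubalgebra, IsStarProjection p ∧ IsStarProjection q ∧
      (∀ k : ℕ, 1 ≤ k → k ≤ n →
        1 / 2 ^ (k - 1) * (τ (NCLevy.eProj (Set.Ioi lam) (NCLevy.partialSum x k))).re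
          ≤ (τ p).re) ∧
      (τ p).re ≤ 2 * (τ (NCLevy.eProj (Set.Ioi lam) (NCLevy.partialSum x n))).re ∧
      (∀ k : ℕ, 1 ≤ k → k ≤ n →
        1 / 2 ^ (k - 1) *
            (τ (NCLevy.eProj (Set.Ioi lam) (NCLevy.absM (NCLevy.partialSum x k)))).re
          ≤ (τ (p + q)).re) ∧
      (τ (p + q)).re ≤
        2 * (τ (NCLevy.eProj (Set.Ioi lam) (NCLevy.absM (NCLevy.partialSum x n)))).re ∧
      ((∃ k : ℕ, 1 ≤ k ∧ k ≤ n ∧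
        NCLevy.eProj (Set.Ioi lam) (NCLevy.partialSum x k) ≠ 0) → p ≠ 0) ∧
      ((∃ k : ℕ, 1 ≤ k ∧ k ≤ n ∧
        NCLevy.eProj (Set.Ioi lam) (-NCLevy.partialSum x k) ≠ 0) → q ≠ 0) := by
  open NCLevy in
  have hx := commute_of_weaklyFullyIndependent hτ hind hcomm
  have hss : ∀ j k, Commute (partialSum x j) (partialSum x k) := fun j k =>
    Commute.sum_left _ _ _ fun i _ => Commute.sum_right _ _ _ fun i' _ => hx i i'
  have hodd := fun k (hk : k ≤ n) => tr_odd_pow_sub_partialSum hτ hsa hind hsymm hx hk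
  have hs := isSelfAdjoint_partialSum hsa
  obtain ⟨p, hp, hpk, hpn⟩ := exists_projection_levy hτ hs hss
    (N := wStarHead x) (N' := wStarTail x) (fun j k h => partialSum_mem_wStarHead h)
    (fun k _ => sub_partialSum_mem_wStarTail x k)
    (fun k h1 hk a b ha hb => hind.map_mul h1 hk ha hb) hodd lam
  have hneg : ∀ k, -partialSum x n - -partialSum x k = -(partialSum x n - partialSum x k) :=
    fun k => by abel
  -- The negated sums satisfy the same hypotheses with the same algebras.
  obtain ⟨q, hq, hqk, hqn⟩ := exists_projection_levy hτ (s := fun k => -partialSum x k)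
    (n := n) (fun k => (hs k).neg) (fun j k => (hss j k).neg_left.neg_right)
    (N := wStarHead x) (N' := wStarTail x)
    (fun j k h => neg_mem (partialSum_mem_wStarHead (x := x) h))
    (fun k _ => by
      simp only [hneg]
      exact neg_mem (sub_partialSum_mem_wStarTail x k))
    (fun k h1 hk a b ha hb => hind.map_mul h1 hk ha hb)
    (fun k hk m hm => by
      simp only [hneg]
      rw [hm.neg_pow, map_neg, hodd k hk m hm, neg_zero]) lam
  -- The weights only weaken the domination of each `e(s_k)` by `p` and each `e(-s_k)` by `q`.
  have hpow : ∀ k : ℕ, (1 : ℝ) / 2 ^ (k - 1) ≤ 1 := fun k => by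
    rw [div_le_one (by positivity)]
    exact one_le_pow₀ one_le_two
  have hscale : ∀ (k : ℕ) {e : M.toStarSubalgebra}, IsStarProjection e →
      1 / 2 ^ (k - 1) * (τ e).re ≤ (τ e).re := fun k e he =>
    mul_le_of_le_one_left (tr_projection_nonneg hτ he).1 (hpow k)
  have hpe := fun k h1 hk => tr_le_of_mul_eq hτ hp (isStarProjection_eProj _ _) (hpk k h1 hk)
  have hqe := fun k h1 hk => tr_le_of_mul_eq hτ hq (isStarProjection_eProj _ _) (hqk k h1 hk)
  refine ⟨p, q, hp, hq, fun k h1 hk => ?_, hpn, fun k h1 hk => ?_, ?_, ?_, ?_⟩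
  · exact (hscale k (isStarProjection_eProj _ _)).trans (hpe k h1 hk)
  · refine (hscale k (isStarProjection_eProj _ _)).trans ?_
    rw [eProj_absM_Ioi (hs k) hlam, map_add, map_add, Complex.add_re, Complex.add_re]
    exact add_le_add (hpe k h1 hk) (hqe k h1 hk)
  · rw [eProj_absM_Ioi (hs n) hlam, map_add, map_add, Complex.add_re, Complex.add_re]
    linarith
  · rintro ⟨k, h1, hk, hne⟩ rfl
    exact hne (by rw [← hpk k h1 hk, zero_mul])
  · rintro ⟨k, h1, hk, hne⟩ rfl
    exact hne (by rw [← hqk k h1 hk, zero_mul])
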